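/- **Theorem.** Let $G=(V,E,\sigma,\tau)$ be a finite directed graph (loops and parallel edges allowed) whose edges $e$ carry labels $\sigma(e)$ and costs $\tau(e)\in\{0,1,2,\dots\}$. The cost of a path is the sum of the costs of its edges, and the path generates the word formed by its edge labels. Suppose that $G$ is strongly connected, deterministic (distinct edges with the same initial vertex have distinct labels) and cost-diverse (there are two paths of the same length, with the same initial and the same terminal vertex, that have different costs). For a vertex $v$ let $N_{G,v}(t,n)$ be the number of words of length $n$ generated by a path of cost at most $t$ that starts in $v$, and let $$C_G(\alpha)=\limsup_{t\to\infty}\frac{\log_2 N_{G,v}(t,\lfloor\alpha t\rfloor)}{t}\qquad(t\in\mathbb N),$$ with the convention $\log_2 0=0$. Let $\rho_G(x)$ be the largest absolute value of an eigenvalue of the $|V|\times|V|$ matrix $P_G(x)$ with entries $[P_G(x)]_{uw}=\sum_{e:\,u\to w}x^{\tau(e)}$. Then $\rho_G$ is differentiable on $(0,\infty)$ with $\rho_G'>0$, and the limit $$\alpha_G^{\mathsf{up}}=\lim_{x\to0^+}\frac{\rho_G(x)}{x\rho_G'(x)}$$ exists in $[-\infty,\infty]$ (the value $+\infty$ is possible).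 Put $\alpha_G^{\mathsf{lo}}=\rho_G(1)/\rho_G'(1)$. For every choice of the starting vertex $v$: 1. if $0\le\alpha\le\alpha_G^{\mathsf{lo}}$, then $C_G(\alpha)=\alpha\log_2\rho_G(1)$; 2. if $\alpha_G^{\mathsf{lo}}<\alpha<\alpha_G^{\mathsf{up}}$, then the equation $\alpha x\rho_G'(x)=\rho_G(x)$ has a unique solution $x_0$ in the interval $0<x<1$, and $C_G(\alpha)=-\log_2x_0+\alpha\log_2\rho_G(x_0)$; 3. if $\alpha>\alpha_G^{\mathsf{up}}$, then $N_{G,v}(t,\lfloor\alpha t\rfloor)=0$ for all sufficiently large $t$, and $C_G(\alpha)=0$. -/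

import Mathlib

open Filter Topology

/-- A labeled, directed graph with vertices `V`, edges `E` (parallel edges and loops are allowed),
edge labels in `S` and natural-number edge costs (cost zero is allowed). -/
structure CostGraph (V E S : Type*) where
  init : E → V
  term : E → V
  label : E → S
  cost : E → ℕ

namespace CostGraph

variable {V E S : Type*}

/-- `G.IsPath u p v`: the edge sequence `p` is a path from `u` to `v`.  The empty sequence is the
path of length zero from a vertex to itself. -/
def IsPath (G : CostGraph V E S) : V → List E → V → Prop
  | u, [], v => u = v
  | u, e :: p, v => G.init e = u ∧ IsPath G (G.term e) p v

/-- The cost of a path: the sum of the costs of its edges. -/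
def pathCost (G : CostGraph V E S) (p : List E) : ℕ := (p.map G.cost).sum

/-- Any two vertices are connected by a path. -/
def StronglyConnected (G : CostGraph V E S) : Prop :=
  ∀ u v : V, ∃ p : List E, G.IsPath u p v

/-- Distinct edges with the same initial vertex have distinct labels. -/
def Deterministic (G : CostGraph V E S) : Prop :=
  ∀ e e' : E, G.init e = G.init e' → G.label e = G.label e' → e = e'

/-- For any two vertices and any length, all paths of that length from the one to the other
have the same cost. -/
def CostUniform (G : CostGraph V E S) : Prop :=
  ∀ (u v : V) (p q : List E), G.IsPath u p v → G.IsPath u q v → p.length = q.length →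
    G.pathCost p = G.pathCost q

/-- A graph that is not cost-uniform. -/
def CostDiverse (G : CostGraph V E S) : Prop := ¬ G.CostUniform

/-- The cost-`t` follower set of `v`: all words generated by some path of cost at most `t` that
starts in `v`. -/
def followerSet (G : CostGraph V E S) (v : V) (t : ℕ) : Set (List S) :=
  {w | ∃ (u : V) (p : List E), G.IsPath v p u ∧ G.pathCost p ≤ t ∧ p.map G.label = w}

/-- The words of length `n` in the cost-`t` follower set of `v`. -/
def followerSetOfLength (G : CostGraph V E S) (v : V) (t n : ℕ) : Set (List S) :=
  G.followerSet v t ∩ {w | w.length = n}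

/-- The number of words of length `n` in the cost-`t` follower set of `v`. -/
noncomputable def followerCount (G : CostGraph V E S) (v : V) (t n : ℕ) : ℕ :=
  (G.followerSetOfLength v t n).ncard

/-- The fixed-length capacity, computed from the starting vertex `v`: the upper limit, in the
extended reals, of `log₂ N(t, ⌊α t⌋) / t` as `t → ∞` through the natural numbers.  The
convention is `log₂ 0 = 0`, which is the value that `Real.logb` takes. -/
noncomputable def fixedLengthCapacity (G : CostGraph V E S) (v : V) (α : ℝ) : EReal :=
  limsup (fun t : ℕ =>
    ((Real.logb 2 (G.followerCount v t ⌊α * (t : ℝ)⌋₊ : ℝ) / (t : ℝ) : ℝ) : EReal)) atTop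

variable [Fintype V] [DecidableEq V] [Fintype E]

/-- The adjacency (cost-enumerator) matrix `P_G(x)`. -/
def adjMatrix (G : CostGraph V E S) (x : ℂ) : Matrix V V ℂ :=
  Matrix.of fun i j => ∑ e : E with G.init e = i ∧ G.term e = j, x ^ G.cost e

/-- The spectral radius `ρ_G(x)`: the largest absolute value of a complex eigenvalue of `P_G(x)`,
as a function of the real variable `x`. -/
noncomputable def rho (G : CostGraph V E S) (x : ℝ) : ℝ :=
  (spectralRadius ℂ (G.adjMatrix (x : ℂ))).toReal

/-- The lower threshold `ρ_G(1) / ρ_G'(1)`. -/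
noncomputable def alphaLo (G : CostGraph V E S) : ℝ :=
  G.rho 1 / deriv G.rho 1

/-- The upper threshold, the limit of `ρ_G(x) / (x ρ_G'(x))` as `x → 0⁺`.  It is taken in the
extended reals because it is `+∞` when the graph has a cycle of cost zero. -/
noncomputable def alphaUp (G : CostGraph V E S) : EReal :=
  limUnder (𝓝[>] (0 : ℝ)) fun x : ℝ => ((G.rho x / (x * deriv G.rho x) : ℝ) : EReal)

end CostGraph

/-! Determinism turns words into paths, so the question is a large-deviation problem for path costs.
Weighting each path by `x ^ cost`, the total weight of the paths of length `n` from `v` lies within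
constant factors of `ρ(x) ^ n`: a positive eigenvector of `P(x)` makes this an exact identity
(`IsPerronPair.sum_pathsFrom`). For `x ≤ 1` a path of cost at most `t` weighs at least `x ^ t`,
hence `N ≤ C x⁻ᵗ ρ(x)ⁿ`. With `n ≈ α t` the exponent is `-log x + α log ρ(x)`, stationary where `α
m(x) = 1`, `m = x ρ' / ρ` (`meanCost`).

The number `m(x)` is the mean edge cost of the stationary Markov chain built from the Perron
eigenvectors, and the derivative of `log ρ` with respect to `log x`. Gibbs' inequality between the
chains at two parameters gives strict convexity (`meanCost_mul_log_sub_lt`); equality would force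
path costs to depend only on length and endpoints, which cost diversity excludes. So `m` is strictly
increasing: the upper threshold exists as a monotone limit, and `α m(x) = 1` has at most one root;
Darboux's theorem supplies it.

For the matching lower bound (`exists_le_followerCount`) take `z < x < y`. The tangent inequality
makes the weight at `x` of the paths with cost outside `[n m(z), n m(y)]` exponentially negligible.
Each remaining path weighs at most `x ^ (n m(z))`, so there are many of them. Letting `x` rise to
`y` and `m(z)` to `m(y)` gives the exponent `α (log ρ(y) - m(y) log y)` whenever `α m(y) ≤ 1`. The
linear region is `y = 1`, the non-linear one `y = x₀`. Beyond the upper threshold some `x` has a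
negative exponent, so the integer `N` is eventually zero. -/

set_option linter.unusedSectionVars false

/-! ### Perron–Frobenius theory for irreducible nonnegative matrices -/

namespace Matrix

variable {n : Type*} [Fintype n] [DecidableEq n]

variable {A : Matrix n n ℝ}

/-- Some sum of powers of an irreducible nonnegative matrix has positive entries. -/
lemma exists_commute_pos (hA : ∀ i j, 0 ≤ A i j) (hirr : ∀ i j, ∃ k : ℕ, 0 < (A ^ k) i j) :
    ∃ B : Matrix n n ℝ, Commute A B ∧ ∀ i j, 0 < B i j := by
  choose k hk using hirr
  set N := (Finset.univ.sup fun p : n × n => k p.1 p.2) + 1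
  refine ⟨∑ l ∈ Finset.range N, A ^ l,
    Commute.sum_right _ _ _ fun l _ => (Commute.refl A).pow_right l, fun i j => ?_⟩
  rw [sum_apply]
  refine Finset.sum_pos' (fun l _ => pow_apply_nonneg hA l i j) ⟨k i j, ?_, hk i j⟩
  rw [Finset.mem_range, Nat.lt_succ_iff]
  exact Finset.le_sup (f := fun p : n × n => k p.1 p.2) (Finset.mem_univ (i, j))

lemma pow_mulVec_of_eigen {w : n → ℝ} {r : ℝ} (h : A *ᵥ w = r • w) (k : ℕ) :
    (A ^ k) *ᵥ w = r ^ k • w := by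
  induction k with
  | zero => simp
  | succ k ih => rw [pow_succ, ← mulVec_mulVec, h, mulVec_smul, ih, smul_smul, pow_succ']

/-- A nonzero nonnegative eigenvector of an irreducible nonnegative matrix is positive. -/
lemma eigenvector_pos (hA : ∀ i j, 0 ≤ A i j) (hirr : ∀ i j, ∃ k : ℕ, 0 < (A ^ k) i j)
    {w : n → ℝ} {r : ℝ} (h : A *ᵥ w = r • w) (hw : ∀ i, 0 ≤ w i) (hne : w ≠ 0) (i : n) :
    0 < w i := by
  obtain ⟨j, hj⟩ := Function.ne_iff.1 hne
  have hj : 0 < w j := lt_of_le_of_ne (hw j) (Ne.symm hj)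
  obtain ⟨k, hk⟩ := hirr i j
  have h1 : ((A ^ k) *ᵥ w) i = r ^ k * w i := by rw [pow_mulVec_of_eigen h]; rfl
  have h2 : 0 < ((A ^ k) *ᵥ w) i :=
    Finset.sum_pos' (fun l _ => mul_nonneg (pow_apply_nonneg hA k i l) (hw l))
      ⟨j, Finset.mem_univ _, mul_pos hk hj⟩
  refine lt_of_le_of_ne (hw i) fun h0 => ?_
  rw [h1, ← h0, mul_zero] at h2
  exact h2.false

/-- Sum the inequalities over `i` and use that coordinates in the simplex are at most 1. This bound
keeps the Collatz–Wielandt set compact. -/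
lemma subeigenvalue_le_sum (hA : ∀ i j, 0 ≤ A i j) {x : n → ℝ} {r : ℝ} (hx : x ∈ stdSimplex ℝ n)
    (h : ∀ i, r * x i ≤ (A *ᵥ x) i) : r ≤ ∑ i, ∑ j, A i j := by
  calc r = ∑ i, r * x i := by rw [← Finset.mul_sum, hx.2, mul_one]
    _ ≤ ∑ i, (A *ᵥ x) i := Finset.sum_le_sum fun i _ => h i
    _ ≤ _ := Finset.sum_le_sum fun i _ => Finset.sum_le_sum fun j _ => by
      have : x j ≤ 1 := hx.2 ▸ Finset.single_le_sum (fun k _ => hx.1 k) (Finset.mem_univ j)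
      exact mul_le_of_le_one_right (hA i j) this

/-- **Perron–Frobenius**: an irreducible nonnegative matrix has a positive eigenvector. -/
theorem exists_perron_eigenvector [Nonempty n] (hA : ∀ i j, 0 ≤ A i j)
    (hirr : ∀ i j, ∃ k : ℕ, 0 < (A ^ k) i j) :
    ∃ (r : ℝ) (w : n → ℝ), 0 ≤ r ∧ (∀ i, 0 < w i) ∧ ∑ i, w i = 1 ∧ A *ᵥ w = r • w := by
  obtain ⟨B, hAB, hB⟩ := exists_commute_pos hA hirr
  have hcomm (x : n → ℝ) : A *ᵥ (B *ᵥ x) = B *ᵥ (A *ᵥ x) := by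
    rw [mulVec_mulVec, mulVec_mulVec, hAB.eq]
  have hBpos {x : n → ℝ} (hx : ∀ i, 0 ≤ x i) (hne : x ≠ 0) (i : n) : 0 < (B *ᵥ x) i := by
    obtain ⟨j, hj⟩ := Function.ne_iff.1 hne
    exact Finset.sum_pos' (fun l _ => mul_nonneg (hB i l).le (hx l))
      ⟨j, Finset.mem_univ _, mul_pos (hB i j) (lt_of_le_of_ne (hx j) (Ne.symm hj))⟩
  set M := ∑ i, ∑ j, A i j
  have hM : 0 ≤ M := Finset.sum_nonneg fun i _ => Finset.sum_nonneg fun j _ => hA i j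
  -- Collatz–Wielandt: the Perron root is the largest `r` with `r x ≤ A x` for some `x` in the
  -- simplex.
  set K : Set ((n → ℝ) × ℝ) :=
    (stdSimplex ℝ n ×ˢ Set.Icc 0 M) ∩ {p | ∀ i, p.2 * p.1 i ≤ (A *ᵥ p.1) i}
  have hK : IsCompact K := by
    refine ((isCompact_stdSimplex ℝ n).prod isCompact_Icc).inter_right ?_
    simp only [Set.ofPred_forall]
    refine isClosed_iInter fun i => isClosed_le (by fun_prop) ?_
    exact (continuous_apply i).comp (continuous_const.matrix_mulVec continuous_fst)
  have hKne : K.Nonempty := by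
    obtain ⟨i⟩ := ‹Nonempty n›
    refine ⟨(Pi.single i 1, 0), ⟨single_mem_stdSimplex ℝ i, le_rfl, hM⟩, fun j => ?_⟩
    simp only [zero_mul]
    refine Finset.sum_nonneg fun l _ => mul_nonneg (hA j l) ?_
    exact (single_mem_stdSimplex ℝ i).1 l
  obtain ⟨⟨x, r⟩, ⟨⟨hx, hr⟩, hsub⟩, hmax⟩ := hK.exists_isMaxOn hKne continuous_snd.continuousOn
  dsimp only at hx hr hsub
  have hsub : ∀ i, r * x i ≤ (A *ᵥ x) i := hsub
  have hxne : x ≠ 0 := by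
    rintro rfl
    simpa using hx.2
  have heig : A *ᵥ x = r • x := by
    -- If the defect `d` were nonzero, applying the positive matrix `B` would make it positive
    -- everywhere, leaving room to increase `r`.
    by_contra hne
    set d := A *ᵥ x - r • x
    have hd : ∀ i, 0 ≤ d i := fun i => sub_nonneg.2 (hsub i)
    have hBd := hBpos hd (sub_ne_zero.2 hne)
    have hBx := hBpos hx.1 hxne
    have hABx : A *ᵥ (B *ᵥ x) = r • (B *ᵥ x) + B *ᵥ d := by
      rw [hcomm, mulVec_sub, mulVec_smul]; abel
    obtain ⟨i₀, -, hi₀⟩ := Finset.exists_min_image Finset.univ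
      (fun i => (B *ᵥ d) i / (B *ᵥ x) i) Finset.univ_nonempty
    set ε := (B *ᵥ d) i₀ / (B *ᵥ x) i₀
    have hε : 0 < ε := div_pos (hBd _) (hBx _)
    set S := ∑ i, (B *ᵥ x) i
    have hS : 0 < S := Finset.sum_pos (fun i _ => hBx i) Finset.univ_nonempty
    have hx' : S⁻¹ • (B *ᵥ x) ∈ stdSimplex ℝ n := by
      refine ⟨fun i => mul_nonneg (inv_nonneg.2 hS.le) (hBx i).le, ?_⟩
      simp only [Pi.smul_apply, smul_eq_mul, ← Finset.mul_sum]
      exact inv_mul_cancel₀ hS.ne'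
    have hsub' : ∀ i, (r + ε) * (S⁻¹ • (B *ᵥ x)) i ≤ (A *ᵥ (S⁻¹ • (B *ᵥ x))) i := fun i => by
      rw [mulVec_smul, hABx]
      simp only [Pi.smul_apply, smul_eq_mul, Pi.add_apply]
      have := (le_div_iff₀ (hBx i)).1 (hi₀ i (Finset.mem_univ _))
      rw [mul_left_comm, add_mul]
      gcongr
    have : r + ε ≤ r := hmax (show (S⁻¹ • (B *ᵥ x), r + ε) ∈ K from
      ⟨⟨hx', add_nonneg hr.1 hε.le, subeigenvalue_le_sum hA hx' hsub'⟩, hsub'⟩)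
    linarith
  exact ⟨r, x, hr.1, eigenvector_pos hA hirr heig hx.1 hxne, hx.2, heig⟩

/-- A left and a right eigenvector with nonzero pairing have the same eigenvalue. -/
lemma eigenvalue_eq_of_dotProduct_ne_zero {l w : n → ℝ} {r r' : ℝ} (hl : l ᵥ* A = r • l)
    (hw : A *ᵥ w = r' • w) (h : l ⬝ᵥ w ≠ 0) : r = r' := by
  have := dotProduct_mulVec l A w
  rw [hl, hw, dotProduct_smul, smul_dotProduct, smul_eq_mul, smul_eq_mul] at this
  exact (mul_right_cancel₀ h this).symm

lemma dotProduct_pos_of_pos [Nonempty n] {l w : n → ℝ} (hl : ∀ i, 0 < l i) (hw : ∀ i, 0 < w i) :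
    0 < l ⬝ᵥ w :=
  Finset.sum_pos (fun i _ => mul_pos (hl i) (hw i)) Finset.univ_nonempty

/-- The left eigenvector comes from the transpose; its eigenvalue agrees because two positive
vectors have positive pairing. -/
theorem exists_perron_eigenvectors [Nonempty n] (hA : ∀ i j, 0 ≤ A i j)
    (hirr : ∀ i j, ∃ k : ℕ, 0 < (A ^ k) i j) :
    ∃ (r : ℝ) (l w : n → ℝ), 0 ≤ r ∧ (∀ i, 0 < l i) ∧ (∀ i, 0 < w i) ∧ ∑ i, w i = 1 ∧
      l ᵥ* A = r • l ∧ A *ᵥ w = r • w := by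
  obtain ⟨r, w, hr, hw, hw1, hwe⟩ := exists_perron_eigenvector hA hirr
  obtain ⟨r', l, -, hl, -, hle⟩ := exists_perron_eigenvector (A := Aᵀ) (fun i j => hA j i)
    (fun i j => by simpa only [← transpose_pow, transpose_apply] using hirr j i)
  rw [mulVec_transpose] at hle
  obtain rfl := eigenvalue_eq_of_dotProduct_ne_zero hle hwe (dotProduct_pos_of_pos hl hw).ne'
  exact ⟨r', l, w, hr, hl, hw, hw1, hle, hwe⟩

/-- The Perron eigenvector of an irreducible nonnegative matrix is unique up to scaling. -/
lemma perron_eigenvector_unique [Nonempty n] (hA : ∀ i j, 0 ≤ A i j)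
    (hirr : ∀ i j, ∃ k : ℕ, 0 < (A ^ k) i j) {w z : n → ℝ} {r : ℝ} (hw : ∀ i, 0 < w i)
    (hw1 : ∑ i, w i = 1) (hz1 : ∑ i, z i = 1) (hwe : A *ᵥ w = r • w) (hze : A *ᵥ z = r • z) :
    z = w := by
  -- Subtract the largest multiple of `w` that keeps `z - c w` nonnegative. The difference vanishes
  -- at `i₀`, so it cannot be a nonzero nonnegative eigenvector.
  obtain ⟨i₀, -, hi₀⟩ := Finset.exists_min_image Finset.univ
    (fun i => z i / w i) Finset.univ_nonempty
  set c := z i₀ / w i₀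
  have hd : ∀ i, 0 ≤ (z - c • w) i := fun i => by
    have := (le_div_iff₀ (hw i)).1 (hi₀ i (Finset.mem_univ _))
    simpa using this
  have hzero : z - c • w = 0 := by
    by_contra hne
    have := eigenvector_pos hA hirr (w := z - c • w) (r := r)
      (by rw [mulVec_sub, mulVec_smul, hwe, hze, smul_sub, smul_comm]) hd hne i₀
    simp [c, (hw i₀).ne'] at this
  have hz : z = c • w := sub_eq_zero.1 hzero
  have hc : c = 1 := by
    have := hz1
    rw [hz] at this
    simpa [← Finset.mul_sum, hw1] using this
  rw [hz, hc, one_smul]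

/-- The eigenvalue of a pair of positive eigenvectors is the spectral radius. -/
theorem spectralRadius_map_ofReal [Nonempty n] (hA : ∀ i j, 0 ≤ A i j) {l w : n → ℝ} {r : ℝ}
    (hr : 0 ≤ r) (hl : ∀ i, 0 < l i) (hw : ∀ i, 0 < w i) (hle : l ᵥ* A = r • l)
    (hwe : A *ᵥ w = r • w) :
    spectralRadius ℂ (A.map ((↑) : ℝ → ℂ)) = ENNReal.ofReal r := by
  have hspec (k : ℂ) : k ∈ spectrum ℂ (A.map ((↑) : ℝ → ℂ)) ↔
      ∃ z : n → ℂ, z ≠ 0 ∧ A.map ((↑) : ℝ → ℂ) *ᵥ z = k • z := by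
    rw [← spectrum_toLin', ← Module.End.hasEigenvalue_iff_mem_spectrum]
    constructor
    · intro h
      obtain ⟨z, hz⟩ := h.exists_hasEigenvector
      exact ⟨z, hz.2, by simpa using hz.apply_eq_smul⟩
    · rintro ⟨z, hz, h⟩
      exact Module.End.hasEigenvalue_of_hasEigenvector
        (x := z) ⟨Module.End.mem_eigenspace_iff.2 (by simpa using h), hz⟩
  apply le_antisymm
  · refine iSup₂_le fun k hk => ?_
    obtain ⟨z, hz, h⟩ := (hspec k).1 hk
    -- The triangle inequality makes `|z|` a subeigenvector for `|k|`; pairing it with the positive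
    -- `l` gives `|k| ≤ r`.
    have hle' : ∀ i, ‖k‖ * ‖z i‖ ≤ (A *ᵥ fun j => ‖z j‖) i := fun i => by
      rw [← norm_mul, ← smul_eq_mul, ← Pi.smul_apply, ← h]
      refine (norm_sum_le _ _).trans (Finset.sum_le_sum fun j _ => ?_)
      simp [abs_of_nonneg (hA i j)]
    have hpos : 0 < l ⬝ᵥ fun j => ‖z j‖ := by
      obtain ⟨j, hj⟩ := Function.ne_iff.1 hz
      exact Finset.sum_pos' (fun i _ => mul_nonneg (hl i).le (norm_nonneg _))
        ⟨j, Finset.mem_univ _, mul_pos (hl j) (norm_pos_iff.2 hj)⟩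
    have hk' : ‖k‖ ≤ r := by
      refine le_of_mul_le_mul_right ?_ hpos
      rw [← smul_eq_mul r, ← smul_dotProduct, ← hle, ← dotProduct_mulVec]
      simp only [dotProduct, Finset.mul_sum]
      refine Finset.sum_le_sum fun i _ => ?_
      rw [mul_left_comm]
      exact mul_le_mul_of_nonneg_left (hle' i) (hl i).le
    rw [ENNReal.ofReal, ENNReal.coe_le_coe]
    exact (Real.le_toNNReal_iff_coe_le hr).2 hk'
  · refine le_trans ?_ (le_iSup₂ (α := ENNReal) (r : ℂ) ((hspec r).2
      ⟨fun i => (w i : ℂ), ?_, ?_⟩))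
    · rw [ENNReal.ofReal, ENNReal.coe_le_coe, Real.toNNReal_le_iff_le_coe, coe_nnnorm,
        Complex.norm_real]
      exact le_abs_self r
    · intro h0
      obtain ⟨i⟩ := ‹Nonempty n›
      exact (hw i).ne' (by simpa using congrFun h0 i)
    · ext i
      have := congrFun hwe i
      simp only [mulVec, dotProduct, Pi.smul_apply, smul_eq_mul, map_apply] at this ⊢
      exact_mod_cast this

end Matrix

/-! ### The cost matrix and its Perron eigenvectors -/

namespace CostGraph

variable {V E S : Type*} [Fintype V] [DecidableEq V] [Fintype E]

open Matrix

/-- The matrix `P_G(x)` for a real argument `x`. -/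
def costMatrix (G : CostGraph V E S) (x : ℝ) : Matrix V V ℝ :=
  Matrix.of fun i j => ∑ e : E with G.init e = i ∧ G.term e = j, x ^ G.cost e

lemma costMatrix_apply (G : CostGraph V E S) (x : ℝ) (i j : V) :
    G.costMatrix x i j = ∑ e : E with G.init e = i ∧ G.term e = j, x ^ G.cost e := rfl

lemma adjMatrix_ofReal (G : CostGraph V E S) (x : ℝ) :
    G.adjMatrix (x : ℂ) = (G.costMatrix x).map ((↑) : ℝ → ℂ) := by
  ext i j
  simp [adjMatrix, costMatrix]

lemma costMatrix_nonneg (G : CostGraph V E S) {x : ℝ} (hx : 0 ≤ x) (i j : V) :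
    0 ≤ G.costMatrix x i j :=
  Finset.sum_nonneg fun _ _ => pow_nonneg hx _

lemma costMatrix_mulVec (G : CostGraph V E S) (x : ℝ) (w : V → ℝ) (i : V) :
    (G.costMatrix x *ᵥ w) i = ∑ e : E with G.init e = i, x ^ G.cost e * w (G.term e) := by
  rw [← Finset.sum_fiberwise _ G.term]
  refine Finset.sum_congr rfl fun j _ => ?_
  change G.costMatrix x i j * w j = _
  rw [costMatrix_apply, Finset.sum_mul, Finset.filter_filter]
  refine Finset.sum_congr rfl fun e he => ?_
  rw [(Finset.mem_filter.1 he).2.2]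

lemma vecMul_costMatrix (G : CostGraph V E S) (x : ℝ) (l : V → ℝ) (j : V) :
    (l ᵥ* G.costMatrix x) j = ∑ e : E with G.term e = j, l (G.init e) * x ^ G.cost e := by
  rw [← Finset.sum_fiberwise _ G.init]
  refine Finset.sum_congr rfl fun i _ => ?_
  change l i * G.costMatrix x i j = _
  rw [costMatrix_apply, Finset.mul_sum, Finset.filter_filter]
  simp_rw [and_comm (a := G.term _ = j)]
  refine Finset.sum_congr rfl fun e he => ?_
  rw [(Finset.mem_filter.1 he).2.1]

lemma costMatrix_apply_pos (G : CostGraph V E S) {x : ℝ} (hx : 0 < x) (e : E) :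
    0 < G.costMatrix x (G.init e) (G.term e) :=
  Finset.sum_pos (fun _ _ => pow_pos hx _) ⟨e, by simp⟩

lemma IsPath.pow_costMatrix_pos {G : CostGraph V E S} {x : ℝ} (hx : 0 < x) {p : List E} {u v : V}
    (hp : G.IsPath u p v) : 0 < (G.costMatrix x ^ p.length) u v := by
  induction p generalizing u with
  | nil => obtain rfl : u = v := hp; simp
  | cons e p ih =>
    obtain ⟨rfl, hp⟩ := hp
    rw [List.length_cons, pow_succ', mul_apply]
    exact Finset.sum_pos' (fun m _ => mul_nonneg (G.costMatrix_nonneg hx.le _ _)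
      (pow_apply_nonneg (G.costMatrix_nonneg hx.le) _ _ _))
      ⟨G.term e, Finset.mem_univ _, mul_pos (G.costMatrix_apply_pos hx e) (ih hp)⟩

lemma StronglyConnected.costMatrix_irreducible {G : CostGraph V E S} (h : G.StronglyConnected)
    {x : ℝ} (hx : 0 < x) (i j : V) : ∃ k : ℕ, 0 < (G.costMatrix x ^ k) i j :=
  let ⟨p, hp⟩ := h i j
  ⟨p.length, hp.pow_costMatrix_pos hx⟩

/-- Positive left and right eigenvectors of `P_G(x)` for the eigenvalue `ρ_G(x)`, the right one
normalized. -/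
structure IsPerronPair (G : CostGraph V E S) (x : ℝ) (l w : V → ℝ) : Prop where
  left_pos : ∀ i, 0 < l i
  right_pos : ∀ i, 0 < w i
  sum_right : ∑ i, w i = 1
  left_eigen : l ᵥ* G.costMatrix x = G.rho x • l
  right_eigen : G.costMatrix x *ᵥ w = G.rho x • w

lemma rho_nonneg (G : CostGraph V E S) (x : ℝ) : 0 ≤ G.rho x := ENNReal.toReal_nonneg

lemma StronglyConnected.exists_isPerronPair [Nonempty V] {G : CostGraph V E S}
    (h : G.StronglyConnected) {x : ℝ} (hx : 0 < x) : ∃ l w, G.IsPerronPair x l w := by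
  obtain ⟨r, l, w, hr, hl, hw, hw1, hle, hwe⟩ :=
    exists_perron_eigenvectors (G.costMatrix_nonneg hx.le) (h.costMatrix_irreducible hx)
  have : G.rho x = r := by
    rw [rho, adjMatrix_ofReal,
      spectralRadius_map_ofReal (G.costMatrix_nonneg hx.le) hr hl hw hle hwe,
      ENNReal.toReal_ofReal hr]
  exact ⟨l, w, hl, hw, hw1, this ▸ hle, this ▸ hwe⟩

namespace IsPerronPair

variable {G : CostGraph V E S} {x : ℝ} {l w : V → ℝ}

lemma left_eq (h : G.IsPerronPair x l w) (j : V) :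
    ∑ e : E with G.term e = j, l (G.init e) * x ^ G.cost e = G.rho x * l j := by
  rw [← vecMul_costMatrix, h.left_eigen]; rfl

lemma right_eq (h : G.IsPerronPair x l w) (i : V) :
    ∑ e : E with G.init e = i, x ^ G.cost e * w (G.term e) = G.rho x * w i := by
  rw [← costMatrix_mulVec, h.right_eigen]; rfl

lemma dotProduct_pos [Nonempty V] (h : G.IsPerronPair x l w) : 0 < l ⬝ᵥ w :=
  dotProduct_pos_of_pos h.left_pos h.right_pos

lemma rho_pos (h : G.IsPerronPair x l w) (hx : 0 < x) (e : E) : 0 < G.rho x := by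
  refine pos_of_mul_pos_left ?_ (h.right_pos (G.init e)).le
  rw [← h.right_eq]
  exact Finset.sum_pos (fun e _ => mul_pos (pow_pos hx _) (h.right_pos _)) ⟨e, by simp⟩

end IsPerronPair

/-! ### Continuity of the eigenvector and differentiability of the spectral radius -/

lemma costMatrix_mono (G : CostGraph V E S) {x y : ℝ} (hx : 0 ≤ x) (hxy : x ≤ y) (i j : V) :
    G.costMatrix x i j ≤ G.costMatrix y i j :=
  Finset.sum_le_sum fun _ _ => pow_le_pow_left₀ hx hxy _

/-- Eigenvector equations pass to the limit. -/
lemma costMatrix_mulVec_eq_of_tendsto {G : CostGraph V E S} {x r : ℝ} {w : ℝ → V → ℝ}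
    {q : ℝ → ℝ} {z : V → ℝ} {F : Filter ℝ} [F.NeBot] (hF : F ≤ 𝓝 x) (hw : Tendsto w F (𝓝 z))
    (hq : Tendsto q F (𝓝 r)) (h : ∀ᶠ y in F, G.costMatrix y *ᵥ w y = q y • w y) :
    G.costMatrix x *ᵥ z = r • z := by
  ext i
  have hwi (j : V) : Tendsto (fun y => w y j) F (𝓝 (z j)) := tendsto_pi_nhds.1 hw j
  have h1 : Tendsto (fun y => (G.costMatrix y *ᵥ w y) i) F (𝓝 ((G.costMatrix x *ᵥ z) i)) := by
    simp only [costMatrix_mulVec]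
    exact tendsto_finsetSum _ fun e _ =>
      (((continuous_pow (G.cost e)).tendsto x).mono_left hF).mul (hwi _)
  refine tendsto_nhds_unique h1 ((hq.mul (hwi i)).congr' ?_)
  filter_upwards [h] with y hy
  rw [hy]; rfl

/-- The normalized right Perron eigenvector depends continuously on the parameter. -/
lemma tendsto_right_perron [Nonempty V] {G : CostGraph V E S} (hG : G.StronglyConnected)
    {l w : ℝ → V → ℝ} (h : ∀ x, 0 < x → G.IsPerronPair x (l x) (w x)) {x : ℝ} (hx : 0 < x) :
    Tendsto w (𝓝 x) (𝓝 (w x)) := by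
  set M := ∑ i, ∑ j, G.costMatrix (x + 1) i j
  have hpos : ∀ᶠ y in 𝓝 x, 0 < y := lt_mem_nhds hx
  have hmem : ∀ᶠ y in 𝓝 x, (w y, G.rho y) ∈ stdSimplex ℝ V ×ˢ Set.Icc 0 M := by
    filter_upwards [hpos, gt_mem_nhds (lt_add_one x)] with y hy hy1
    have hw : w y ∈ stdSimplex ℝ V := ⟨fun i => ((h y hy).right_pos i).le, (h y hy).sum_right⟩
    refine ⟨hw, G.rho_nonneg y, ?_⟩
    refine (subeigenvalue_le_sum (G.costMatrix_nonneg hy.le) hw fun i => ?_).trans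
      (Finset.sum_le_sum fun i _ => Finset.sum_le_sum fun j _ => G.costMatrix_mono hy.le hy1.le i j)
    rw [(h y hy).right_eigen]; rfl
  -- The pairs stay in a compact set, and every cluster point is a normalized nonnegative eigenpair
  -- at `x`, of which there is only one.
  have key : Tendsto (fun y => (w y, G.rho y)) (𝓝 x) (𝓝 (w x, G.rho x)) := by
    refine ((isCompact_stdSimplex ℝ V).prod isCompact_Icc).tendsto_nhds_of_unique_mapClusterPt
      hmem ?_
    rintro ⟨z, r⟩ ⟨hz, -⟩ hcl
    obtain ⟨U, hU, hlim⟩ := mapClusterPt_iff_ultrafilter.1 hcl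
    have hlz : Tendsto w U (𝓝 z) := (continuous_fst.tendsto (z, r)).comp hlim
    have hlr : Tendsto G.rho U (𝓝 r) := (continuous_snd.tendsto (z, r)).comp hlim
    have hze : G.costMatrix x *ᵥ z = r • z := costMatrix_mulVec_eq_of_tendsto hU hlz hlr <| by
      filter_upwards [hU hpos] with y hy
      exact (h y hy).right_eigen
    have hz0 : z ≠ 0 := by
      rintro rfl
      simpa using hz.2
    have hzpos := eigenvector_pos (G.costMatrix_nonneg hx.le) (hG.costMatrix_irreducible hx)
      hze hz.1 hz0
    have hr : G.rho x = r := eigenvalue_eq_of_dotProduct_ne_zero (h x hx).left_eigen hze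
      (dotProduct_pos_of_pos (h x hx).left_pos hzpos).ne'
    subst hr
    have hz1 : ∑ i, z i = 1 := hz.2
    rw [perron_eigenvector_unique (G.costMatrix_nonneg hx.le) (hG.costMatrix_irreducible hx)
      (h x hx).right_pos (h x hx).sum_right hz1 (h x hx).right_eigen hze]
  exact (continuous_fst.tendsto _).comp key

/-- The derivative of `P_G`, paired with the Perron eigenvectors, gives the derivative of `ρ_G`. -/
theorem IsPerronPair.hasDerivAt_rho [Nonempty V] {G : CostGraph V E S} (hG : G.StronglyConnected)
    {x : ℝ} (hx : 0 < x) {l₀ w₀ : V → ℝ} (h₀ : G.IsPerronPair x l₀ w₀) :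
    HasDerivAt G.rho ((∑ e, l₀ (G.init e) * (G.cost e * x ^ (G.cost e - 1)) * w₀ (G.term e)) /
      l₀ ⬝ᵥ w₀) x := by
  choose l w h using fun (y : ℝ) (hy : 0 < y) => hG.exists_isPerronPair hy
  set w' : ℝ → V → ℝ := fun y => if hy : 0 < y then w y hy else 0 with hw'
  set l' : ℝ → V → ℝ := fun y => if hy : 0 < y then l y hy else 0 with hl'
  have h' : ∀ y, 0 < y → G.IsPerronPair y (l' y) (w' y) := fun y hy => by
    simpa only [hw', hl', dif_pos hy] using h y hy
  have hww : w' x = w₀ := perron_eigenvector_unique (G.costMatrix_nonneg hx.le)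
    (hG.costMatrix_irreducible hx) h₀.right_pos h₀.sum_right (h' x hx).sum_right h₀.right_eigen
    (h' x hx).right_eigen
  have hcont : Tendsto w' (𝓝[≠] x) (𝓝 w₀) :=
    hww ▸ (tendsto_right_perron hG h' hx).mono_left nhdsWithin_le_nhds
  have hcont' (i : V) : Tendsto (fun y => w' y i) (𝓝[≠] x) (𝓝 (w₀ i)) :=
    ((continuous_apply i).tendsto _).comp hcont
  rw [hasDerivAt_iff_tendsto_slope]
  have hnum : Tendsto (fun y => ∑ e, l₀ (G.init e) * slope (fun y => y ^ G.cost e) x y *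
      w' y (G.term e)) (𝓝[≠] x)
      (𝓝 (∑ e, l₀ (G.init e) * (G.cost e * x ^ (G.cost e - 1)) * w₀ (G.term e))) :=
    tendsto_finsetSum _ fun e _ => ((hasDerivAt_iff_tendsto_slope.1
      (hasDerivAt_pow (G.cost e) x)).const_mul _).mul (hcont' _)
  have hden : Tendsto (fun y => l₀ ⬝ᵥ w' y) (𝓝[≠] x) (𝓝 (l₀ ⬝ᵥ w₀)) :=
    tendsto_finsetSum _ fun i _ => (hcont' i).const_mul _
  refine (hnum.div hden h₀.dotProduct_pos.ne').congr' ?_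
  filter_upwards [mem_nhdsWithin_of_mem_nhds (lt_mem_nhds hx), self_mem_nhdsWithin] with y hy hne
  have hd : 0 < l₀ ⬝ᵥ w' y := dotProduct_pos_of_pos h₀.left_pos (h' y hy).right_pos
  have hyx : y - x ≠ 0 := sub_ne_zero.2 hne
  -- Evaluate `l₀ P(y) w(y)` by the right eigenvector at `y` and `l₀ P(x) w(y)` by the left one at
  -- `x`. The difference is `(ρ(y) - ρ(x)) l₀ · w(y)`, so only `w` need be continuous.
  have e1 : ∑ e, l₀ (G.init e) * y ^ G.cost e * w' y (G.term e) = G.rho y * l₀ ⬝ᵥ w' y := by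
    rw [← Finset.sum_fiberwise _ G.init, dotProduct, Finset.mul_sum]
    refine Finset.sum_congr rfl fun i _ => ?_
    rw [mul_left_comm, ← (h' y hy).right_eq, Finset.mul_sum]
    refine Finset.sum_congr rfl fun e he => ?_
    rw [(Finset.mem_filter.1 he).2, mul_assoc]
  have e2 : ∑ e, l₀ (G.init e) * x ^ G.cost e * w' y (G.term e) = G.rho x * l₀ ⬝ᵥ w' y := by
    rw [← Finset.sum_fiberwise _ G.term, dotProduct, Finset.mul_sum]
    refine Finset.sum_congr rfl fun j _ => ?_
    rw [← mul_assoc, ← h₀.left_eq, Finset.sum_mul]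
    refine Finset.sum_congr rfl fun e he => ?_
    rw [(Finset.mem_filter.1 he).2]
  rw [Pi.div_apply, div_eq_iff hd.ne', slope_def_field, div_mul_eq_mul_div, eq_div_iff hyx, sub_mul, ← e1, ← e2,
    ← Finset.sum_sub_distrib, Finset.sum_mul]
  refine Finset.sum_congr rfl fun e _ => ?_
  rw [slope_def_field]
  field_simp

/-! ### Mean cost, entropy and strict convexity -/

lemma CostDiverse.exists_edge_cost_pos {G : CostGraph V E S} (h : G.CostDiverse) :
    ∃ e, 0 < G.cost e := by
  by_contra! h0
  have hz (p : List E) : G.pathCost p = 0 := by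
    rw [pathCost, List.sum_eq_zero_iff]
    intro c hc
    obtain ⟨e, -, rfl⟩ := List.mem_map.1 hc
    exact Nat.le_zero.1 (h0 e)
  exact h fun u v p q _ _ _ => by rw [hz, hz]

/-- The weight of an edge under the (unnormalized) stationary measure of the Perron pair. -/
def edgeWeight (G : CostGraph V E S) (x : ℝ) (l w : V → ℝ) (e : E) : ℝ :=
  l (G.init e) * x ^ G.cost e * w (G.term e)

/-- The mean edge cost `x ρ_G'(x) / ρ_G(x)`, that is, the logarithmic derivative of `ρ_G`. -/
noncomputable def meanCost (G : CostGraph V E S) (x : ℝ) : ℝ :=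
  x * deriv G.rho x / G.rho x

namespace IsPerronPair

variable {G : CostGraph V E S} {x : ℝ} {l w : V → ℝ}

lemma edgeWeight_pos (h : G.IsPerronPair x l w) (hx : 0 < x) (e : E) :
    0 < G.edgeWeight x l w e :=
  mul_pos (mul_pos (h.left_pos _) (pow_pos hx _)) (h.right_pos _)

/-- Stationarity: together with `sum_edgeWeight_mul_term` it shows that both vertex marginals of the
edge measure are `ρ l w`, so averages of `g (term e) - g (init e)` vanish. -/
lemma sum_edgeWeight_mul_init (h : G.IsPerronPair x l w) (g : V → ℝ) :
    ∑ e, G.edgeWeight x l w e * g (G.init e) = G.rho x * ∑ i, l i * w i * g i := by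
  rw [← Finset.sum_fiberwise _ G.init, Finset.mul_sum]
  refine Finset.sum_congr rfl fun i _ => ?_
  rw [show G.rho x * (l i * w i * g i) = l i * g i * (G.rho x * w i) by ring, ← h.right_eq,
    Finset.mul_sum]
  refine Finset.sum_congr rfl fun e he => ?_
  rw [edgeWeight, (Finset.mem_filter.1 he).2]
  ring

lemma sum_edgeWeight_mul_term (h : G.IsPerronPair x l w) (g : V → ℝ) :
    ∑ e, G.edgeWeight x l w e * g (G.term e) = G.rho x * ∑ i, l i * w i * g i := by
  rw [← Finset.sum_fiberwise _ G.term, Finset.mul_sum]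
  refine Finset.sum_congr rfl fun i _ => ?_
  rw [show G.rho x * (l i * w i * g i) = (G.rho x * l i) * (w i * g i) by ring, ← h.left_eq,
    Finset.sum_mul]
  refine Finset.sum_congr rfl fun e he => ?_
  rw [edgeWeight, (Finset.mem_filter.1 he).2]
  ring

lemma sum_edgeWeight (h : G.IsPerronPair x l w) :
    ∑ e, G.edgeWeight x l w e = G.rho x * l ⬝ᵥ w := by
  simpa [dotProduct] using h.sum_edgeWeight_mul_init fun _ => 1

/-- Multiplying the derivative of `x ^ cost` by `x` weights each edge by its cost; this is why
`meanCost` is a mean. -/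
lemma sum_edgeWeight_mul_cost [Nonempty V] (h : G.IsPerronPair x l w) (hG : G.StronglyConnected)
    (hx : 0 < x) (hρ : 0 < G.rho x) :
    ∑ e, G.edgeWeight x l w e * G.cost e = G.meanCost x * ∑ e, G.edgeWeight x l w e := by
  rw [meanCost, (h.hasDerivAt_rho hG hx).deriv, h.sum_edgeWeight]
  have hd := h.dotProduct_pos
  have : ∑ e, G.edgeWeight x l w e * G.cost e =
      x * ∑ e, l (G.init e) * (G.cost e * x ^ (G.cost e - 1)) * w (G.term e) := by
    rw [Finset.mul_sum]
    refine Finset.sum_congr rfl fun e _ => ?_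
    rw [edgeWeight]
    rcases Nat.eq_zero_or_pos (G.cost e) with h0 | h0
    · simp [h0]
    · rw [← mul_pow_sub_one h0.ne' x]
      ring
  rw [this]
  field_simp

lemma deriv_rho_pos [Nonempty V] (h : G.IsPerronPair x l w) (hG : G.StronglyConnected)
    (hdiv : G.CostDiverse) (hx : 0 < x) : 0 < deriv G.rho x := by
  rw [(h.hasDerivAt_rho hG hx).deriv]
  refine div_pos ?_ h.dotProduct_pos
  obtain ⟨e, he⟩ := hdiv.exists_edge_cost_pos
  refine Finset.sum_pos' (fun e _ => ?_) ⟨e, Finset.mem_univ _, ?_⟩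
  · have := (h.left_pos (G.init e)).le
    have := (h.right_pos (G.term e)).le
    positivity
  · have := h.left_pos (G.init e)
    have := h.right_pos (G.term e)
    positivity

/-- The entropy of the stationary Markov chain of a Perron pair is nonnegative. -/
lemma meanCost_mul_log_le [Nonempty V] (h : G.IsPerronPair x l w) (hG : G.StronglyConnected)
    (hx : 0 < x) (hρ : 0 < G.rho x) : G.meanCost x * Real.log x ≤ Real.log (G.rho x) := by
  have hT : 0 < ∑ e, G.edgeWeight x l w e := by
    rw [h.sum_edgeWeight]; exact mul_pos hρ h.dotProduct_pos
  -- One summand of the eigenvector equation at `init e` is at most the whole sum: transition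
  -- probabilities are at most 1.
  have hedge (e : E) : G.cost e * Real.log x + Real.log (w (G.term e)) ≤
      Real.log (G.rho x) + Real.log (w (G.init e)) := by
    rw [← Real.log_pow, ← Real.log_mul (pow_pos hx _).ne' (h.right_pos _).ne',
      ← Real.log_mul hρ.ne' (h.right_pos _).ne', ← h.right_eq]
    refine Real.log_le_log (mul_pos (pow_pos hx _) (h.right_pos _)) ?_
    exact Finset.single_le_sum (f := fun e => x ^ G.cost e * w (G.term e))
      (fun e _ => (mul_pos (pow_pos hx _) (h.right_pos _)).le) (by simp)
  have hsum := Finset.sum_le_sum fun e (_ : e ∈ Finset.univ) =>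
    mul_le_mul_of_nonneg_left (hedge e) (h.edgeWeight_pos hx e).le
  simp only [mul_add, Finset.sum_add_distrib, ← mul_assoc, ← Finset.sum_mul] at hsum
  rw [h.sum_edgeWeight_mul_term fun v => Real.log (w v),
    h.sum_edgeWeight_mul_init fun v => Real.log (w v), h.sum_edgeWeight_mul_cost hG hx hρ] at hsum
  refine le_of_mul_le_mul_left ?_ hT
  linarith

end IsPerronPair

/-- The potential `g` telescopes along the path. When `δ ≠ 0`, the cost therefore depends only on
the length and the endpoints. -/
lemma pathCost_mul_eq {G : CostGraph V E S} {κ δ : ℝ} {g : V → ℝ}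
    (h : ∀ e, G.cost e * δ = κ + (g (G.init e) - g (G.term e))) {p : List E} {u v : V}
    (hp : G.IsPath u p v) : G.pathCost p * δ = p.length * κ + (g u - g v) := by
  induction p generalizing u with
  | nil => obtain rfl : u = v := hp; simp [pathCost]
  | cons e p ih =>
    obtain ⟨rfl, hp⟩ := hp
    have h1 := ih hp
    have h2 := h e
    simp only [pathCost, List.map_cons, List.sum_cons, List.length_cons] at h1 ⊢
    push_cast at h1 ⊢
    linarith

/-- Strict tangent inequality: `log ρ_G` is a strictly convex function of `log x`, with derivative
`meanCost`. -/
theorem meanCost_mul_log_sub_lt [Nonempty V] {G : CostGraph V E S} (hG : G.StronglyConnected)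
    (hdiv : G.CostDiverse) {x y : ℝ} (hx : 0 < x) (hy : 0 < y) (hxy : x ≠ y) :
    G.meanCost x * (Real.log y - Real.log x) < Real.log (G.rho y) - Real.log (G.rho x) := by
  obtain ⟨l, w, h⟩ := hG.exists_isPerronPair hx
  obtain ⟨l', w', h'⟩ := hG.exists_isPerronPair hy
  obtain ⟨e₀, -⟩ := hdiv.exists_edge_cost_pos
  have hρ := h.rho_pos hx e₀
  have hρ' := h'.rho_pos hy e₀
  have hT : 0 < ∑ e, G.edgeWeight x l w e := by
    rw [h.sum_edgeWeight]; exact mul_pos hρ h.dotProduct_pos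
  set g : V → ℝ := fun v => Real.log (w' v) - Real.log (w v) with hg
  -- Ratio of the transition probabilities of the chains at `y` and `x`; averaging `log z ≤ z - 1`
  -- is Gibbs' inequality.
  set z : E → ℝ := fun e => (y ^ G.cost e * w' (G.term e) / (G.rho y * w' (G.init e))) /
    (x ^ G.cost e * w (G.term e) / (G.rho x * w (G.init e))) with hz
  have hzpos (e : E) : 0 < z e := by
    have := h.right_pos (G.init e)
    have := h.right_pos (G.term e)
    have := h'.right_pos (G.init e)
    have := h'.right_pos (G.term e)
    positivity
  have hlog (e : E) : Real.log (z e) = G.cost e * (Real.log y - Real.log x) -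
      (Real.log (G.rho y) - Real.log (G.rho x)) + (g (G.term e) - g (G.init e)) := by
    have h1 := (h.right_pos (G.init e)).ne'
    have h2 := (h.right_pos (G.term e)).ne'
    have h3 := (h'.right_pos (G.init e)).ne'
    have h4 := (h'.right_pos (G.term e)).ne'
    have h5 := (pow_pos hx (G.cost e)).ne'
    have h6 := (pow_pos hy (G.cost e)).ne'
    simp only [hz, hg]
    rw [Real.log_div (by positivity) (by positivity), Real.log_div (by positivity) (by positivity),
      Real.log_div (by positivity) (by positivity), Real.log_mul h6 h4, Real.log_mul hρ'.ne' h3,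
      Real.log_mul h5 h2, Real.log_mul hρ.ne' h1, Real.log_pow, Real.log_pow]
    ring
  have hsum1 : ∑ e, G.edgeWeight x l w e * Real.log (z e) = (∑ e, G.edgeWeight x l w e) *
      (G.meanCost x * (Real.log y - Real.log x) -
        (Real.log (G.rho y) - Real.log (G.rho x))) := by
    simp only [hlog, mul_add, mul_sub, Finset.sum_add_distrib, Finset.sum_sub_distrib, ← mul_assoc,
      ← Finset.sum_mul]
    rw [h.sum_edgeWeight_mul_term g, h.sum_edgeWeight_mul_init g,
      h.sum_edgeWeight_mul_cost hG hx hρ]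
    ring
  -- The ratio has mean 1, because the transition probabilities at `y` out of each vertex also sum
  -- to 1.
  have hsum2 : ∑ e, G.edgeWeight x l w e * z e = ∑ e, G.edgeWeight x l w e := by
    have h1 (e : E) : G.edgeWeight x l w e * z e = y ^ G.cost e * w' (G.term e) *
        (l (G.init e) * (G.rho x * w (G.init e)) / (G.rho y * w' (G.init e))) := by
      have h1 := (h.right_pos (G.init e)).ne'
      have h2 := (h.right_pos (G.term e)).ne'
      have h3 := (h'.right_pos (G.init e)).ne'
      have h5 := (pow_pos hx (G.cost e)).ne'
      simp only [hz, edgeWeight]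
      field_simp
    simp only [h1]
    rw [h.sum_edgeWeight, ← Finset.sum_fiberwise _ G.init, dotProduct, Finset.mul_sum]
    refine Finset.sum_congr rfl fun i _ => ?_
    have h3 := (h'.right_pos i).ne'
    calc _ = ∑ e with G.init e = i, y ^ G.cost e * w' (G.term e) *
          (l i * (G.rho x * w i) / (G.rho y * w' i)) :=
        Finset.sum_congr rfl fun e he => by rw [(Finset.mem_filter.1 he).2]
      _ = _ := by
        rw [← Finset.sum_mul, h'.right_eq]
        field_simp
  -- If all ratios were 1, edge costs would be a constant plus a coboundary, contradicting cost
  -- diversity.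
  obtain ⟨e₁, he₁⟩ : ∃ e, z e ≠ 1 := by
    by_contra! hall
    have hδ : Real.log y - Real.log x ≠ 0 :=
      sub_ne_zero.2 fun h0 => hxy (Real.log_injOn_pos hx hy h0.symm)
    have hc (e : E) : G.cost e * (Real.log y - Real.log x) =
        (Real.log (G.rho y) - Real.log (G.rho x)) + (g (G.init e) - g (G.term e)) := by
      have := hlog e
      rw [hall e, Real.log_one] at this
      linarith
    refine hdiv fun u v p q hp hq hlen => ?_
    have := (pathCost_mul_eq hc hp).trans (hlen ▸ (pathCost_mul_eq hc hq).symm)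
    exact_mod_cast mul_right_cancel₀ hδ this
  have hlt : ∑ e, G.edgeWeight x l w e * Real.log (z e) <
      ∑ e, G.edgeWeight x l w e * (z e - 1) :=
    Finset.sum_lt_sum
      (fun e _ => mul_le_mul_of_nonneg_left (Real.log_le_sub_one_of_pos (hzpos e))
        (h.edgeWeight_pos hx e).le)
      ⟨e₁, Finset.mem_univ _, mul_lt_mul_of_pos_left (Real.log_lt_sub_one_of_pos (hzpos e₁) he₁)
        (h.edgeWeight_pos hx e₁)⟩
  simp only [mul_sub (G.edgeWeight x l w _) (z _) 1, mul_one, Finset.sum_sub_distrib] at hlt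
  rw [hsum2, sub_self, hsum1] at hlt
  linarith [neg_of_mul_neg_right hlt hT.le]

/-! ### Monotonicity of the mean cost and the two thresholds -/

section Rho

variable {G : CostGraph V E S} (hG : G.StronglyConnected) (hdiv : G.CostDiverse)

lemma CostDiverse.nonempty {G : CostGraph V E S} (h : G.CostDiverse) : Nonempty V :=
  let ⟨e, _⟩ := h.exists_edge_cost_pos
  ⟨G.init e⟩

lemma rho_div_eq (G : CostGraph V E S) (x : ℝ) :
    G.rho x / (x * deriv G.rho x) = (G.meanCost x)⁻¹ := by
  rw [meanCost, inv_div]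

include hG hdiv

lemma rho_pos {x : ℝ} (hx : 0 < x) : 0 < G.rho x := by
  have := hdiv.nonempty
  obtain ⟨e, -⟩ := hdiv.exists_edge_cost_pos
  obtain ⟨l, w, h⟩ := hG.exists_isPerronPair hx
  exact h.rho_pos hx e

lemma differentiableAt_rho {x : ℝ} (hx : 0 < x) : DifferentiableAt ℝ G.rho x := by
  have := hdiv.nonempty
  obtain ⟨l, w, h⟩ := hG.exists_isPerronPair hx
  exact (h.hasDerivAt_rho hG hx).differentiableAt

lemma deriv_rho_pos {x : ℝ} (hx : 0 < x) : 0 < deriv G.rho x := by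
  have := hdiv.nonempty
  obtain ⟨l, w, h⟩ := hG.exists_isPerronPair hx
  exact h.deriv_rho_pos hG hdiv hx

lemma meanCost_pos {x : ℝ} (hx : 0 < x) : 0 < G.meanCost x :=
  div_pos (mul_pos hx (deriv_rho_pos hG hdiv hx)) (rho_pos hG hdiv hx)

lemma meanCost_mul_log_le {x : ℝ} (hx : 0 < x) :
    G.meanCost x * Real.log x ≤ Real.log (G.rho x) := by
  have := hdiv.nonempty
  obtain ⟨l, w, h⟩ := hG.exists_isPerronPair hx
  exact h.meanCost_mul_log_le hG hx (rho_pos hG hdiv hx)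

/-- Add the two strict tangent inequalities, from `x` to `y` and from `y` to `x`. -/
lemma strictMonoOn_meanCost : StrictMonoOn G.meanCost (Set.Ioi 0) := by
  have := hdiv.nonempty
  intro x (hx : 0 < x) y (hy : 0 < y) hxy
  have h1 := meanCost_mul_log_sub_lt hG hdiv hx hy hxy.ne
  have h2 := meanCost_mul_log_sub_lt hG hdiv hy hx hxy.ne'
  have h3 : 0 < Real.log y - Real.log x := sub_pos.2 (Real.log_lt_log hx hxy)
  nlinarith

/-- In the variable `s = log x` the mean cost is a derivative, so Darboux's theorem applies without
continuity of `ρ'`. -/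
lemma hasDerivAt_log_rho_exp (s : ℝ) :
    HasDerivAt (fun s => Real.log (G.rho (Real.exp s))) (G.meanCost (Real.exp s)) s := by
  have h := ((differentiableAt_rho hG hdiv (Real.exp_pos s)).hasDerivAt.comp s
    (Real.hasDerivAt_exp s)).log (rho_pos hG hdiv (Real.exp_pos s)).ne'
  refine h.congr_deriv ?_
  simp only [meanCost, Function.comp_apply]
  rw [mul_comm]

/-- The mean cost has the intermediate value property. -/
lemma exists_meanCost_eq {u v μ : ℝ} (hu : 0 < u) (huv : u < v) (h1 : G.meanCost u < μ)
    (h2 : μ < G.meanCost v) : ∃ z ∈ Set.Ioo u v, G.meanCost z = μ := by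
  have hv := hu.trans huv
  obtain ⟨s, hs, hsμ⟩ := exists_hasDerivWithinAt_eq_of_gt_of_lt
    (Real.log_le_log hu huv.le)
    (fun s _ => (hasDerivAt_log_rho_exp hG hdiv s).hasDerivWithinAt)
    (m := μ) (by rwa [Real.exp_log hu]) (by rwa [Real.exp_log hv])
  exact ⟨Real.exp s, ⟨(Real.log_lt_iff_lt_exp hu).1 hs.1, (Real.lt_log_iff_exp_lt hv).1 hs.2⟩, hsμ⟩

lemma strictAntiOn_inv_meanCost : StrictAntiOn (fun x => (G.meanCost x)⁻¹) (Set.Ioi 0) :=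
  fun _ hx _ hy hxy => inv_strictAnti₀ (meanCost_pos hG hdiv hx)
    (strictMonoOn_meanCost hG hdiv hx hy hxy)

/-- The quotient is the reciprocal of the increasing mean cost, so its limit at `0⁺` is its
supremum, possibly `+∞`. -/
lemma tendsto_alphaUp_sSup :
    Tendsto (fun x : ℝ => ((G.rho x / (x * deriv G.rho x) : ℝ) : EReal)) (𝓝[>] (0 : ℝ))
      (𝓝 (sSup ((fun x => (((G.meanCost x)⁻¹ : ℝ) : EReal)) '' Set.Ioi 0))) := by
  simp only [rho_div_eq]
  refine AntitoneOn.tendsto_nhdsGT ?_ (OrderTop.bddAbove _)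
  exact fun x hx y hy hxy => EReal.coe_le_coe_iff.2
    ((strictAntiOn_inv_meanCost hG hdiv).antitoneOn hx hy hxy)

lemma alphaUp_eq_sSup :
    G.alphaUp = sSup ((fun x => (((G.meanCost x)⁻¹ : ℝ) : EReal)) '' Set.Ioi 0) :=
  (tendsto_alphaUp_sSup hG hdiv).limUnder_eq

lemma alphaLo_eq : G.alphaLo = (G.meanCost 1)⁻¹ := by
  rw [← rho_div_eq, alphaLo, one_mul]

lemma inv_meanCost_le_alphaUp {x : ℝ} (hx : 0 < x) :
    (((G.meanCost x)⁻¹ : ℝ) : EReal) ≤ G.alphaUp := by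
  rw [alphaUp_eq_sSup hG hdiv]
  exact le_sSup (Set.mem_image_of_mem _ hx)

lemma mul_deriv_rho_eq_iff {α x : ℝ} (hx : 0 < x) :
    α * x * deriv G.rho x = G.rho x ↔ α * G.meanCost x = 1 := by
  have := (rho_pos hG hdiv hx).ne'
  rw [meanCost]
  field_simp

/-- In the non-linear region the mean cost takes the value `1 / α`. -/
lemma exists_mul_meanCost_eq_one {α : ℝ} (h1 : G.alphaLo < α) (h2 : (α : EReal) < G.alphaUp) :
    ∃ x ∈ Set.Ioo (0 : ℝ) 1, α * G.meanCost x = 1 := by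
  rw [alphaLo_eq hG hdiv] at h1
  have hm := meanCost_pos hG hdiv one_pos
  have hα : 0 < α := (inv_pos.2 hm).trans h1
  rw [alphaUp_eq_sSup hG hdiv, lt_sSup_iff] at h2
  obtain ⟨_, ⟨u, hu, rfl⟩, h2⟩ := h2
  have hu : 0 < u := hu
  have h2 : α < (G.meanCost u)⁻¹ := EReal.coe_lt_coe_iff.1 h2
  have hu1 : u < 1 := by
    by_contra! hle
    exact (((strictAntiOn_inv_meanCost hG hdiv).antitoneOn (Set.mem_Ioi.2 one_pos) hu hle).trans_lt
      h1).not_gt h2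
  obtain ⟨z, hz, hze⟩ := exists_meanCost_eq hG hdiv hu hu1 (μ := α⁻¹)
    ((lt_inv_comm₀ hα (meanCost_pos hG hdiv hu)).1 h2) ((inv_lt_comm₀ hm hα).1 h1)
  exact ⟨z, ⟨hu.trans hz.1, hz.2⟩, by rw [hze, mul_inv_cancel₀ hα.ne']⟩

/-- Beyond the upper threshold, the exponential bound on the number of words decays for a suitable
parameter. -/
lemma exists_neg_exponent {α : ℝ} (h : G.alphaUp < (α : EReal)) :
    0 < α ∧ ∃ x ∈ Set.Ioo (0 : ℝ) 1, -Real.log x + α * Real.log (G.rho x) < 0 := by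
  have := hdiv.nonempty
  obtain ⟨β, hβ, hβα⟩ := EReal.lt_iff_exists_real_btwn.1 h
  have hβα : β < α := EReal.coe_lt_coe_iff.1 hβα
  have hm {x : ℝ} (hx : 0 < x) : (G.meanCost x)⁻¹ < β :=
    EReal.coe_lt_coe_iff.1 ((inv_meanCost_le_alphaUp hG hdiv hx).trans_lt hβ)
  have hβ0 : 0 < β := (inv_pos.2 (meanCost_pos hG hdiv one_pos)).trans (hm one_pos)
  have hα0 := hβ0.trans hβα
  refine ⟨hα0, ?_⟩
  -- the value at `1` bounds `log ρ` along the tangent of slope `β⁻¹`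
  have hbound {x : ℝ} (hx : x ∈ Set.Ioo (0 : ℝ) 1) :
      Real.log (G.rho x) ≤ Real.log (G.rho 1) + β⁻¹ * Real.log x := by
    have h1 := meanCost_mul_log_sub_lt hG hdiv hx.1 one_pos hx.2.ne
    have h2 : β⁻¹ < G.meanCost x := (inv_lt_comm₀ (meanCost_pos hG hdiv hx.1) hβ0).1 (hm hx.1)
    have h3 := Real.log_neg hx.1 hx.2
    rw [Real.log_one] at h1
    nlinarith
  have hγ : 0 < α * β⁻¹ - 1 := by
    rw [sub_pos, ← div_eq_mul_inv, one_lt_div hβ0]; exact hβα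
  have hlim : Tendsto (fun x => α * Real.log (G.rho 1) + (α * β⁻¹ - 1) * Real.log x) (𝓝[>] 0)
      atBot :=
    tendsto_atBot_add_const_left _ _ (Real.tendsto_log_nhdsGT_zero.const_mul_atBot hγ)
  obtain ⟨x, hx, hx'⟩ := ((hlim.eventually (eventually_lt_atBot 0)).and
    (Ioo_mem_nhdsGT one_pos)).exists
  refine ⟨x, hx', ?_⟩
  have := mul_le_mul_of_nonneg_left (hbound hx') hα0.le
  linarith

end Rho

/-! ### Counting paths: Chernoff bounds from above and below -/

open Classical in
/-- The paths of a given length that start in a given vertex. -/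
noncomputable def pathsFrom (G : CostGraph V E S) : ℕ → V → Finset (List E)
  | 0, _ => {[]}
  | n + 1, v => (Finset.univ.filter fun e => G.init e = v).biUnion fun e =>
      (pathsFrom G n (G.term e)).image (List.cons e)

/-- The terminal vertex of a path that starts in `v`. -/
def endpoint (G : CostGraph V E S) (v : V) (p : List E) : V :=
  p.foldl (fun _ e => G.term e) v

lemma mem_pathsFrom {G : CostGraph V E S} {n : ℕ} {v : V} {p : List E} :
    p ∈ G.pathsFrom n v ↔ p.length = n ∧ ∃ u, G.IsPath v p u := by
  induction n generalizing v p with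
  | zero =>
    rw [pathsFrom, Finset.mem_singleton, List.length_eq_zero_iff]
    exact ⟨fun h => ⟨h, v, h ▸ rfl⟩, fun h => h.1⟩
  | succ n ih =>
    simp only [pathsFrom, Finset.mem_biUnion, Finset.mem_filter, Finset.mem_univ, true_and,
      Finset.mem_image, ih]
    constructor
    · rintro ⟨e, he, q, ⟨hq, u, hu⟩, rfl⟩
      exact ⟨by simp [hq], u, he, hu⟩
    · rintro ⟨hlen, u, hu⟩
      cases p with
      | nil => simp at hlen
      | cons e q => exact ⟨e, hu.1, q, ⟨by simpa using hlen, u, hu.2⟩, rfl⟩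

lemma sum_pathsFrom_succ (G : CostGraph V E S) (n : ℕ) (v : V) (F : List E → ℝ) :
    ∑ p ∈ G.pathsFrom (n + 1) v, F p =
      ∑ e with G.init e = v, ∑ p ∈ G.pathsFrom n (G.term e), F (e :: p) := by
  classical
  rw [pathsFrom, Finset.sum_biUnion]
  · refine Finset.sum_congr (by congr) fun e _ => ?_
    rw [Finset.sum_image (List.cons_injective.injOn)]
  · intro e _ e' _ hne
    refine Finset.disjoint_left.2 fun p hp hp' => hne ?_
    obtain ⟨q, -, rfl⟩ := Finset.mem_image.1 hp
    obtain ⟨q', -, h⟩ := Finset.mem_image.1 hp'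
    exact (List.cons_eq_cons.1 h).1.symm

/-- Iterate the right eigenvector equation; the factor `w` at the endpoint makes the identity exact.
-/
lemma IsPerronPair.sum_pathsFrom {G : CostGraph V E S} {x : ℝ} {l w : V → ℝ}
    (h : G.IsPerronPair x l w) (n : ℕ) (v : V) :
    ∑ p ∈ G.pathsFrom n v, x ^ G.pathCost p * w (G.endpoint v p) = G.rho x ^ n * w v := by
  induction n generalizing v with
  | zero => simp [pathsFrom, pathCost, endpoint]
  | succ n ih =>
    rw [sum_pathsFrom_succ, pow_succ, mul_assoc, ← h.right_eq, Finset.mul_sum]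
    refine Finset.sum_congr rfl fun e _ => ?_
    rw [mul_left_comm, ← ih, Finset.mul_sum]
    refine Finset.sum_congr rfl fun p _ => ?_
    simp only [pathCost, endpoint, List.map_cons, List.sum_cons, List.foldl_cons, pow_add, mul_assoc]

/-- The generating function of the path costs grows like `ρ_G(x) ^ n`. -/
lemma exists_sum_pathsFrom_bounds [Nonempty V] {G : CostGraph V E S} (hG : G.StronglyConnected)
    {x : ℝ} (hx : 0 < x) :
    ∃ C : ℝ, 0 < C ∧ ∀ n v, ∑ p ∈ G.pathsFrom n v, x ^ G.pathCost p ≤ C * G.rho x ^ n ∧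
      G.rho x ^ n ≤ C * ∑ p ∈ G.pathsFrom n v, x ^ G.pathCost p := by
  obtain ⟨l, w, h⟩ := hG.exists_isPerronPair hx
  obtain ⟨i₀, -, hi₀⟩ := Finset.exists_min_image Finset.univ w Finset.univ_nonempty
  have hb := h.right_pos i₀
  have hle (v : V) : w v ≤ 1 :=
    h.sum_right ▸ Finset.single_le_sum (fun i _ => (h.right_pos i).le) (Finset.mem_univ v)
  -- All entries of `w` lie between its minimum `w i₀` and 1, so dropping the endpoint factor costs
  -- at most `(w i₀)⁻¹`.
  refine ⟨(w i₀)⁻¹, inv_pos.2 hb, fun n v => ⟨?_, ?_⟩⟩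
  · rw [le_inv_mul_iff₀ hb, mul_comm, Finset.sum_mul]
    refine (Finset.sum_le_sum fun p _ => ?_).trans ((h.sum_pathsFrom n v).trans_le
      (mul_le_of_le_one_right (pow_nonneg (G.rho_nonneg x) n) (hle v)))
    exact mul_le_mul_of_nonneg_left (hi₀ _ (Finset.mem_univ _)) (pow_nonneg hx.le _)
  · rw [le_inv_mul_iff₀ hb, mul_comm]
    refine (mul_le_mul_of_nonneg_left (hi₀ v (Finset.mem_univ _))
      (pow_nonneg (G.rho_nonneg x) n)).trans ((h.sum_pathsFrom n v).symm.trans_le ?_)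
    exact Finset.sum_le_sum fun p _ => mul_le_of_le_one_right (pow_nonneg hx.le _) (hle _)

lemma Deterministic.injOn_map_label {G : CostGraph V E S} (hdet : G.Deterministic) {v : V}
    {p q : List E} {u u' : V} (hp : G.IsPath v p u) (hq : G.IsPath v q u')
    (h : p.map G.label = q.map G.label) : p = q := by
  induction p generalizing v q with
  | nil => simpa [eq_comm] using h
  | cons e p ih =>
    cases q with
    | nil => simp at h
    | cons e' q =>
      simp only [List.map_cons, List.cons.injEq] at h
      obtain rfl : e = e' := hdet e e' (hp.1.trans hq.1.symm) h.1
      rw [ih hp.2 hq.2 h.2]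

/-- In a deterministic graph, words correspond to paths. -/
lemma followerCount_eq_card {G : CostGraph V E S} (hdet : G.Deterministic) (v : V) (t n : ℕ) :
    G.followerCount v t n = ((G.pathsFrom n v).filter fun p => G.pathCost p ≤ t).card := by
  have h : G.followerSetOfLength v t n =
      List.map G.label '' ((G.pathsFrom n v).filter fun p => G.pathCost p ≤ t : Finset _) := by
    ext w
    simp only [followerSetOfLength, followerSet, Set.mem_inter_iff, Set.mem_ofPred_eq, Set.mem_image,
      Finset.mem_coe, Finset.mem_filter, mem_pathsFrom]
    constructor
    · rintro ⟨⟨u, p, hp, hc, rfl⟩, hl⟩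
      exact ⟨p, ⟨⟨by simpa using hl, u, hp⟩, hc⟩, rfl⟩
    · rintro ⟨p, ⟨⟨hl, u, hp⟩, hc⟩, rfl⟩
      exact ⟨⟨u, p, hp, hc, rfl⟩, by simpa using hl⟩
  rw [followerCount, h, Set.InjOn.ncard_image, Set.ncard_coe_finset]
  intro p hp q hq hpq
  simp only [Finset.mem_coe, Finset.mem_filter, mem_pathsFrom] at hp hq
  obtain ⟨⟨-, u, hu⟩, -⟩ := hp
  obtain ⟨⟨-, u', hu'⟩, -⟩ := hq
  exact hdet.injOn_map_label hu hu' hpq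

/-- The exponential upper bound on the number of words. -/
lemma exists_followerCount_le [Nonempty V] {G : CostGraph V E S} (hG : G.StronglyConnected)
    (hdet : G.Deterministic) {x : ℝ} (hx : 0 < x) (hx1 : x ≤ 1) :
    ∃ C : ℝ, 0 < C ∧ ∀ v t n, (G.followerCount v t n : ℝ) * x ^ t ≤ C * G.rho x ^ n := by
  obtain ⟨C, hC, h⟩ := exists_sum_pathsFrom_bounds hG hx
  refine ⟨C, hC, fun v t n => le_trans ?_ (h n v).1⟩
  rw [followerCount_eq_card hdet, ← nsmul_eq_mul]
  refine (Finset.card_nsmul_le_sum _ (fun p => x ^ G.pathCost p) _ fun p hp => ?_).trans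
    (Finset.sum_le_sum_of_subset_of_nonneg (Finset.filter_subset _ _)
      fun _ _ _ => pow_nonneg hx.le _)
  exact pow_le_pow_of_le_one hx.le hx1 (Finset.mem_filter.1 hp).2

/-- Chernoff bound for the upper tail: when the cost exceeds `t`, `x ^ cost ≤ (x / y) ^ t * y ^
cost`. -/
lemma sum_pathsFrom_cost_gt_le {G : CostGraph V E S} {x y : ℝ} (hx : 0 < x) (hxy : x ≤ y)
    (n t : ℕ) (v : V) :
    ∑ p ∈ G.pathsFrom n v with t < G.pathCost p, x ^ G.pathCost p ≤
      Real.exp (-(t * (Real.log y - Real.log x))) * ∑ p ∈ G.pathsFrom n v, y ^ G.pathCost p := by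
  have hy := hx.trans_le hxy
  rw [Finset.mul_sum]
  refine (Finset.sum_le_sum fun p hp => ?_).trans
    (Finset.sum_le_sum_of_subset_of_nonneg (Finset.filter_subset _ _)
      fun _ _ _ => mul_nonneg (Real.exp_pos _).le (pow_nonneg hy.le _))
  have ht : (t : ℝ) ≤ G.pathCost p := by exact_mod_cast (Finset.mem_filter.1 hp).2.le
  rw [← Real.exp_log (pow_pos hx _), ← Real.exp_log (pow_pos hy _), ← Real.exp_add, Real.log_pow,
    Real.log_pow]
  refine Real.exp_le_exp.2 ?_
  nlinarith [Real.log_le_log hx hxy]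

/-- Lower-tail counterpart; the threshold is real because `n m(z)` need not be an integer. -/
lemma sum_pathsFrom_cost_lt_le {G : CostGraph V E S} {x z : ℝ} (hz : 0 < z) (hzx : z ≤ x)
    (n : ℕ) (a : ℝ) (v : V) :
    ∑ p ∈ G.pathsFrom n v with (G.pathCost p : ℝ) < a, x ^ G.pathCost p ≤
      Real.exp (a * (Real.log x - Real.log z)) * ∑ p ∈ G.pathsFrom n v, z ^ G.pathCost p := by
  have hx := hz.trans_le hzx
  rw [Finset.mul_sum]
  refine (Finset.sum_le_sum fun p hp => ?_).trans
    (Finset.sum_le_sum_of_subset_of_nonneg (Finset.filter_subset _ _)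
      fun _ _ _ => mul_nonneg (Real.exp_pos _).le (pow_nonneg hz.le _))
  have ht := (Finset.mem_filter.1 hp).2
  rw [← Real.exp_log (pow_pos hx _), ← Real.exp_log (pow_pos hz _), ← Real.exp_add, Real.log_pow,
    Real.log_pow]
  refine Real.exp_le_exp.2 ?_
  nlinarith [Real.log_le_log hz hzx]

/-- A path outside both tails has cost in `[a, t]`, so it is counted by `followerCount` and, as `x ≤
1`, weighs at most `x ^ a`. -/
lemma sum_pathsFrom_le_add {G : CostGraph V E S} (hdet : G.Deterministic) {x : ℝ} (hx : 0 < x)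
    (hx1 : x ≤ 1) (n t : ℕ) (a : ℝ) (v : V) :
    ∑ p ∈ G.pathsFrom n v, x ^ G.pathCost p ≤
      G.followerCount v t n * Real.exp (a * Real.log x) +
      ∑ p ∈ G.pathsFrom n v with t < G.pathCost p, x ^ G.pathCost p +
      ∑ p ∈ G.pathsFrom n v with (G.pathCost p : ℝ) < a, x ^ G.pathCost p := by
  rw [followerCount_eq_card hdet, ← nsmul_eq_mul, ← Finset.sum_const, Finset.sum_filter,
    Finset.sum_filter, Finset.sum_filter, ← Finset.sum_add_distrib, ← Finset.sum_add_distrib]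
  refine Finset.sum_le_sum fun p _ => ?_
  have h0 : 0 < x ^ G.pathCost p := pow_pos hx _
  have h1 := Real.exp_pos (a * Real.log x)
  rcases lt_or_ge t (G.pathCost p) with h | h
  · rw [if_neg h.not_ge, if_pos h]
    split_ifs <;> linarith
  · rw [if_pos h, if_neg h.not_gt]
    split_ifs with h'
    · linarith
    · have : x ^ G.pathCost p ≤ Real.exp (a * Real.log x) := by
        rw [← Real.exp_log h0, Real.log_pow]
        exact Real.exp_le_exp.2 (mul_le_mul_of_nonpos_right (not_lt.1 h')
          (Real.log_nonpos hx.le hx1))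
      linarith

/-- The exponential lower bound on the number of words: most of the weight of the paths is carried
by those whose cost is close to the mean cost. -/
lemma exists_le_followerCount {G : CostGraph V E S} (hG : G.StronglyConnected)
    (hdet : G.Deterministic) (hdiv : G.CostDiverse) {x y z : ℝ} (hz : 0 < z) (hzx : z < x)
    (hxy : x < y) (hx1 : x ≤ 1) :
    ∃ c : ℝ, 0 < c ∧ ∀ᶠ n : ℕ in atTop, ∀ (t : ℕ) (v : V), n * G.meanCost y ≤ t →
      c * Real.exp (n * (Real.log (G.rho x) - G.meanCost z * Real.log x)) ≤
        G.followerCount v t n := by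
  have := hdiv.nonempty
  have hx := hz.trans hzx
  have hy := hx.trans hxy
  obtain ⟨Cx, hCx, hbx⟩ := exists_sum_pathsFrom_bounds hG hx
  obtain ⟨Cy, hCy, hby⟩ := exists_sum_pathsFrom_bounds hG hy
  obtain ⟨Cz, hCz, hbz⟩ := exists_sum_pathsFrom_bounds hG hz
  -- The gaps in the tangent inequalities at `y` and `z` are the decay rates of the upper and lower
  -- tails.
  set δ := Real.log (G.rho x) - Real.log (G.rho y) -
    G.meanCost y * (Real.log x - Real.log y) with hδ
  set η := Real.log (G.rho x) - Real.log (G.rho z) -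
    G.meanCost z * (Real.log x - Real.log z) with hη
  have hδ0 : 0 < δ := sub_pos.2 (meanCost_mul_log_sub_lt hG hdiv hy hx hxy.ne')
  have hη0 : 0 < η := sub_pos.2 (meanCost_mul_log_sub_lt hG hdiv hz hx hzx.ne)
  have hpow {u : ℝ} (hu : 0 < u) (n : ℕ) : G.rho u ^ n = Real.exp (n * Real.log (G.rho u)) := by
    rw [← Real.log_pow, Real.exp_log (pow_pos (rho_pos hG hdiv hu) n)]
  have hexp {d : ℝ} (hd : 0 < d) (C : ℝ) :
      Tendsto (fun n : ℕ => C * Real.exp (-(n * d))) atTop (𝓝 0) := by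
    have := (Real.tendsto_exp_neg_atTop_nhds_zero.comp
      (tendsto_natCast_atTop_atTop.atTop_mul_const hd)).const_mul C
    simpa using this
  have hlim := (hexp hδ0 Cy).add (hexp hη0 Cz)
  rw [add_zero] at hlim
  -- The total weight is at least `Cx⁻¹ ρ(x)ⁿ`; eventually the tails take less than half of that.
  refine ⟨Cx⁻¹ / 2, by positivity, ?_⟩
  filter_upwards [hlim.eventually (gt_mem_nhds (show 0 < Cx⁻¹ / 2 by positivity))]
    with n hn t v ht
  have h1 := sum_pathsFrom_le_add hdet hx hx1 n t (n * G.meanCost z) v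
  have h2 : ∑ p ∈ G.pathsFrom n v with t < G.pathCost p, x ^ G.pathCost p ≤
      Cy * Real.exp (-(n * δ)) * G.rho x ^ n := by
    refine (sum_pathsFrom_cost_gt_le hx hxy.le n t v).trans
      ((mul_le_mul_of_nonneg_left (hby n v).1 (Real.exp_pos _).le).trans ?_)
    rw [hpow hx, hpow hy, mul_left_comm, mul_assoc, ← Real.exp_add, ← Real.exp_add]
    refine mul_le_mul_of_nonneg_left (Real.exp_le_exp.2 ?_) hCy.le
    have := mul_le_mul_of_nonneg_right ht (sub_nonneg.2 (Real.log_le_log hx hxy.le))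
    rw [hδ]
    linarith
  have h3 : ∑ p ∈ G.pathsFrom n v with (G.pathCost p : ℝ) < n * G.meanCost z,
      x ^ G.pathCost p ≤ Cz * Real.exp (-(n * η)) * G.rho x ^ n := by
    refine (sum_pathsFrom_cost_lt_le hz hzx.le n _ v).trans
      ((mul_le_mul_of_nonneg_left (hbz n v).1 (Real.exp_pos _).le).trans ?_)
    rw [hpow hx, hpow hz, mul_left_comm, ← Real.exp_add, mul_assoc Cz, ← Real.exp_add]
    refine mul_le_mul_of_nonneg_left (Real.exp_le_exp.2 ?_) hCz.le
    rw [hη]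
    linarith
  have h4 : Cx⁻¹ * G.rho x ^ n ≤ ∑ p ∈ G.pathsFrom n v, x ^ G.pathCost p := by
    rw [inv_mul_le_iff₀ hCx]; exact (hbx n v).2
  have h5 : 0 < G.rho x ^ n := pow_pos (rho_pos hG hdiv hx) n
  have h6 : Cx⁻¹ / 2 * G.rho x ^ n ≤
      G.followerCount v t n * Real.exp (n * G.meanCost z * Real.log x) := by
    have := mul_le_mul_of_nonneg_right hn.le h5.le
    linarith
  rw [mul_sub, Real.exp_sub, ← hpow hx, ← mul_assoc, ← mul_div_assoc, div_le_iff₀ (Real.exp_pos _)]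
  exact h6

lemma tendsto_floor_mul_div {α : ℝ} (hα : 0 ≤ α) :
    Tendsto (fun t : ℕ => (⌊α * (t : ℝ)⌋₊ : ℝ) / t) atTop (𝓝 α) :=
  (tendsto_nat_floor_mul_div_atTop hα).comp tendsto_natCast_atTop_atTop

lemma tendsto_floor_mul {α : ℝ} (hα : 0 < α) :
    Tendsto (fun t : ℕ => ⌊α * (t : ℝ)⌋₊) atTop atTop :=
  tendsto_nat_floor_atTop.comp (tendsto_natCast_atTop_atTop.const_mul_atTop hα)

lemma limsup_coe_le_of_tendsto {u b : ℕ → ℝ} {L : ℝ} (h : ∀ᶠ t in atTop, u t ≤ b t)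
    (hb : Tendsto b atTop (𝓝 L)) : limsup (fun t => (u t : EReal)) atTop ≤ (L : EReal) := by
  rw [← ((continuous_coe_real_ereal.tendsto L).comp hb).limsup_eq]
  exact limsup_le_limsup (h.mono fun t ht => EReal.coe_le_coe_iff.2 ht)

lemma le_limsup_coe_of_tendsto {u b : ℕ → ℝ} {L : ℝ} (h : ∀ᶠ t in atTop, b t ≤ u t)
    (hb : Tendsto b atTop (𝓝 L)) : (L : EReal) ≤ limsup (fun t => (u t : EReal)) atTop := by
  rw [← ((continuous_coe_real_ereal.tendsto L).comp hb).limsup_eq]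
  exact limsup_le_limsup (h.mono fun t ht => EReal.coe_le_coe_iff.2 ht)

/-! ### Bounds for the fixed-length capacity -/

section Capacity

variable {G : CostGraph V E S} (hG : G.StronglyConnected) (hdet : G.Deterministic)
  (hdiv : G.CostDiverse)

include hG hdet hdiv

/-- Take logarithms in `exists_followerCount_le` at `n = ⌊α t⌋`. The maximum with 0 covers empty
counts, whose logarithm is 0 by convention. -/
lemma fixedLengthCapacity_le (v : V) {α x : ℝ} (hα : 0 ≤ α) (hx : 0 < x) (hx1 : x ≤ 1) :
    G.fixedLengthCapacity v α ≤
      ((max 0 ((-Real.log x + α * Real.log (G.rho x)) / Real.log 2) : ℝ) : EReal) := by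
  have := hdiv.nonempty
  obtain ⟨C, hC, h⟩ := exists_followerCount_le hG hdet hx hx1
  have hρ := rho_pos hG hdiv hx
  have hl2 : 0 < Real.log 2 := Real.log_pos one_lt_two
  have hlim : Tendsto (fun t : ℕ => max 0 ((Real.log C / t + -Real.log x +
      (⌊α * (t : ℝ)⌋₊ : ℝ) / t * Real.log (G.rho x)) / Real.log 2)) atTop
      (𝓝 (max 0 ((0 + -Real.log x + α * Real.log (G.rho x)) / Real.log 2))) :=
    tendsto_const_nhds.max (((((tendsto_const_div_atTop_nhds_zero_nat _).add_const _).add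
      ((tendsto_floor_mul_div hα).mul_const _))).div_const _)
  rw [zero_add] at hlim
  refine limsup_coe_le_of_tendsto ?_ hlim
  filter_upwards [eventually_gt_atTop 0] with t ht
  have ht : (0 : ℝ) < t := by exact_mod_cast ht
  rcases Nat.eq_zero_or_pos (G.followerCount v t ⌊α * (t : ℝ)⌋₊) with h0 | h0
  · simp [h0]
  · refine le_max_of_le_right ?_
    have hN : (0 : ℝ) < G.followerCount v t ⌊α * (t : ℝ)⌋₊ := by exact_mod_cast h0
    have h1 := Real.log_le_log (mul_pos hN (pow_pos hx _)) (h v t ⌊α * (t : ℝ)⌋₊)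
    rw [Real.log_mul hN.ne' (pow_pos hx _).ne', Real.log_mul hC.ne' (pow_pos hρ _).ne',
      Real.log_pow, Real.log_pow] at h1
    rw [Real.logb, div_right_comm]
    refine div_le_div_of_nonneg_right ?_ hl2.le
    rw [div_le_iff₀ ht]
    have : (Real.log C / t + -Real.log x +
        (⌊α * (t : ℝ)⌋₊ : ℝ) / t * Real.log (G.rho x)) * t =
        Real.log C - t * Real.log x + ⌊α * (t : ℝ)⌋₊ * Real.log (G.rho x) := by
      field_simp
      ring
    rw [this]
    linarith

lemma le_fixedLengthCapacity_of_lt (v : V) {α x y z : ℝ} (hα : 0 < α) (hz : 0 < z) (hzx : z < x)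
    (hxy : x < y) (hx1 : x ≤ 1) (hαy : α * G.meanCost y ≤ 1) :
    ((α * (Real.log (G.rho x) - G.meanCost z * Real.log x) / Real.log 2 : ℝ) : EReal) ≤
      G.fixedLengthCapacity v α := by
  obtain ⟨c, hc, h⟩ := exists_le_followerCount hG hdet hdiv hz hzx hxy hx1
  have hl2 : 0 < Real.log 2 := Real.log_pos one_lt_two
  set K := Real.log (G.rho x) - G.meanCost z * Real.log x with hK
  have hlim : Tendsto (fun t : ℕ => (Real.log c / t + (⌊α * (t : ℝ)⌋₊ : ℝ) / t * K) / Real.log 2)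
      atTop (𝓝 ((0 + α * K) / Real.log 2)) :=
    (((tendsto_const_div_atTop_nhds_zero_nat _).add
      ((tendsto_floor_mul_div hα.le).mul_const _))).div_const _
  rw [zero_add] at hlim
  refine le_limsup_coe_of_tendsto ?_ hlim
  filter_upwards [eventually_gt_atTop 0, (tendsto_floor_mul hα).eventually h] with t ht hN
  have ht : (0 : ℝ) < t := by exact_mod_cast ht
  have hm := meanCost_pos hG hdiv (hz.trans (hzx.trans hxy))
  have hle : (⌊α * (t : ℝ)⌋₊ : ℝ) * G.meanCost y ≤ t := by
    have h1 : (⌊α * (t : ℝ)⌋₊ : ℝ) ≤ α * t := Nat.floor_le (by positivity)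
    nlinarith
  have h1 := Real.log_le_log (mul_pos hc (Real.exp_pos _)) (hN t v hle)
  rw [Real.log_mul hc.ne' (Real.exp_pos _).ne', Real.log_exp] at h1
  rw [Real.logb, div_right_comm]
  refine div_le_div_of_nonneg_right ?_ hl2.le
  rw [le_div_iff₀ ht]
  refine le_trans (le_of_eq ?_) h1
  field_simp

/-- The lower bound for the capacity. -/
lemma le_fixedLengthCapacity (v : V) {α y : ℝ} (hα : 0 < α) (hy : 0 < y) (hy1 : y ≤ 1)
    (hαy : α * G.meanCost y ≤ 1) :
    ((α * (Real.log (G.rho y) - G.meanCost y * Real.log y) / Real.log 2 : ℝ) : EReal) ≤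
      G.fixedLengthCapacity v α := by
  -- Two successive limits: first `x` rises to `y` with `μ` fixed, then `μ` rises to the mean cost
  -- at `y`. Here `μ` stands in for the mean cost at `z`.
  have key {μ : ℝ} (hμ : μ < G.meanCost y) :
      ((α * (Real.log (G.rho y) - μ * Real.log y) / Real.log 2 : ℝ) : EReal) ≤
        G.fixedLengthCapacity v α := by
    obtain ⟨z, hz, hzμ⟩ : ∃ z ∈ Set.Ioo 0 y, μ ≤ G.meanCost z := by
      rcases le_or_gt μ (G.meanCost (y / 2)) with h | h
      · exact ⟨y / 2, ⟨by linarith, by linarith⟩, h⟩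
      · obtain ⟨z, hz, h⟩ := exists_meanCost_eq hG hdiv (half_pos hy) (half_lt_self hy) h hμ
        exact ⟨z, ⟨(half_pos hy).trans hz.1, hz.2⟩, h.ge⟩
    have hcont : ContinuousAt
        (fun x => α * (Real.log (G.rho x) - μ * Real.log x) / Real.log 2) y :=
      (continuousAt_const.mul ((((differentiableAt_rho hG hdiv hy).continuousAt.log
        (rho_pos hG hdiv hy).ne')).sub (continuousAt_const.mul
          (Real.continuousAt_log hy.ne')))).div_const _
    refine le_of_tendsto ((continuous_coe_real_ereal.tendsto _).comp
      (hcont.tendsto.mono_left (nhdsWithin_le_nhds (s := Set.Iio y)))) ?_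
    filter_upwards [Ioo_mem_nhdsLT hz.2] with x hx
    refine le_trans ?_ (le_fixedLengthCapacity_of_lt hG hdet hdiv v hα hz.1 hx.1 hx.2
      (hx.2.le.trans hy1) hαy)
    refine EReal.coe_le_coe_iff.2 (div_le_div_of_nonneg_right (mul_le_mul_of_nonneg_left ?_ hα.le)
      (Real.log_pos one_lt_two).le)
    exact sub_le_sub_left (mul_le_mul_of_nonpos_right hzμ
      (Real.log_nonpos (hz.1.trans hx.1).le (hx.2.le.trans hy1))) _
  have hcont : Continuous
      fun μ : ℝ => α * (Real.log (G.rho y) - μ * Real.log y) / Real.log 2 := by fun_prop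
  refine le_of_tendsto ((continuous_coe_real_ereal.tendsto _).comp
    ((hcont.tendsto (G.meanCost y)).mono_left (nhdsWithin_le_nhds (s := Set.Iio (G.meanCost y))))) ?_
  filter_upwards [self_mem_nhdsWithin] with μ hμ using key hμ

lemma followerCount_eventually_eq_zero (v : V) {α : ℝ} (h : G.alphaUp < (α : EReal)) :
    ∀ᶠ t : ℕ in atTop, G.followerCount v t ⌊α * (t : ℝ)⌋₊ = 0 := by
  have := hdiv.nonempty
  obtain ⟨hα, x, hx, hneg⟩ := exists_neg_exponent hG hdiv h
  obtain ⟨C, hC, hN⟩ := exists_followerCount_le hG hdet hx.1 hx.2.le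
  have hlim : Tendsto (fun t : ℕ => Real.log C / t + -Real.log x +
      (⌊α * (t : ℝ)⌋₊ : ℝ) / t * Real.log (G.rho x)) atTop
      (𝓝 (0 + -Real.log x + α * Real.log (G.rho x))) :=
    ((tendsto_const_div_atTop_nhds_zero_nat _).add_const _).add
      ((tendsto_floor_mul_div hα.le).mul_const _)
  rw [zero_add] at hlim
  filter_upwards [eventually_gt_atTop 0, hlim.eventually (gt_mem_nhds hneg)] with t ht hlt
  have ht : (0 : ℝ) < t := by exact_mod_cast ht
  -- A nonzero count is at least 1, which is incompatible with a negative exponent.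
  by_contra h0
  have h1 : (1 : ℝ) ≤ G.followerCount v t ⌊α * (t : ℝ)⌋₊ := by
    exact_mod_cast Nat.one_le_iff_ne_zero.2 h0
  have h2 := (mul_le_mul_of_nonneg_right h1 (pow_pos hx.1 t).le).trans (hN v t _)
  rw [one_mul] at h2
  have h3 := Real.log_le_log (pow_pos hx.1 t) h2
  rw [Real.log_mul hC.ne' (pow_pos (rho_pos hG hdiv hx.1) _).ne', Real.log_pow, Real.log_pow] at h3
  have h4 := mul_neg_of_neg_of_pos hlt ht
  have h5 : (Real.log C / t + -Real.log x +
        (⌊α * (t : ℝ)⌋₊ : ℝ) / t * Real.log (G.rho x)) * t =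
        Real.log C - t * Real.log x + ⌊α * (t : ℝ)⌋₊ * Real.log (G.rho x) := by
    field_simp
    ring
  linarith

end Capacity

end CostGraph

/-! ### The capacity formula -/

open CostGraph in
theorem mainTheorem2 {V E S : Type*} [Fintype V] [DecidableEq V] [Fintype E]
    (G : CostGraph V E S) (hconn : G.StronglyConnected) (hdet : G.Deterministic)
    (hdiv : G.CostDiverse) :
    -- the thresholds are well defined
    (∀ x : ℝ, 0 < x → DifferentiableAt ℝ G.rho x ∧ 0 < deriv G.rho x) ∧
    Tendsto (fun x : ℝ => ((G.rho x / (x * deriv G.rho x) : ℝ) : EReal)) (𝓝[>] (0 : ℝ))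
      (𝓝 G.alphaUp) ∧
    -- the linear region
    (∀ (v : V) (α : ℝ), 0 ≤ α → α ≤ G.alphaLo →
      G.fixedLengthCapacity v α = ((α * Real.logb 2 (G.rho 1) : ℝ) : EReal)) ∧
    -- the non-linear region
    (∀ α : ℝ, G.alphaLo < α → (α : EReal) < G.alphaUp →
      ∃ x₀ ∈ Set.Ioo (0 : ℝ) 1,
        α * x₀ * deriv G.rho x₀ = G.rho x₀ ∧
        (∀ x ∈ Set.Ioo (0 : ℝ) 1, α * x * deriv G.rho x = G.rho x → x = x₀) ∧
        ∀ v : V, G.fixedLengthCapacity v α =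
          ((-Real.logb 2 x₀ + α * Real.logb 2 (G.rho x₀) : ℝ) : EReal)) ∧
    -- beyond the upper threshold
    (∀ (v : V) (α : ℝ), G.alphaUp < (α : EReal) →
      (∀ᶠ t : ℕ in atTop, G.followerCount v t ⌊α * (t : ℝ)⌋₊ = 0) ∧
      G.fixedLengthCapacity v α = 0) := by
  have hl2 : 0 < Real.log 2 := Real.log_pos one_lt_two
  refine ⟨fun x hx => ⟨differentiableAt_rho hconn hdiv hx, deriv_rho_pos hconn hdiv hx⟩, ?_, ?_,
    ?_, ?_⟩
  · rw [alphaUp_eq_sSup hconn hdiv]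
    exact tendsto_alphaUp_sSup hconn hdiv
  · intro v α hα hαlo
    have hm := meanCost_pos hconn hdiv one_pos
    rw [alphaLo_eq hconn hdiv, ← one_div, le_div_iff₀ hm] at hαlo
    -- Nonnegative entropy at `x = 1` reads `0 ≤ log ρ(1)`, which removes the maximum with 0 from
    -- the upper bound.
    have hent := meanCost_mul_log_le hconn hdiv one_pos
    rw [Real.log_one, mul_zero] at hent
    have hrw : α * Real.logb 2 (G.rho 1) = α * Real.log (G.rho 1) / Real.log 2 := by
      rw [Real.logb, mul_div_assoc]
    have hnn : 0 ≤ α * Real.log (G.rho 1) / Real.log 2 := by positivity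
    rw [hrw]
    apply le_antisymm
    · have := fixedLengthCapacity_le hconn hdet hdiv v hα one_pos le_rfl
      rwa [Real.log_one, neg_zero, zero_add, max_eq_right hnn] at this
    -- For `α = 0` the length `⌊α t⌋` does not tend to infinity, so the asymptotic lower bound is
    -- unavailable; nonnegativity suffices.
    · rcases hα.eq_or_lt with rfl | hα
      · rw [zero_mul, zero_div]
        refine le_limsup_coe_of_tendsto (b := fun _ => 0) (Eventually.of_forall fun t => ?_)
          tendsto_const_nhds
        exact div_nonneg (div_nonneg (Real.log_natCast_nonneg _) hl2.le) (Nat.cast_nonneg _)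
      · have := le_fixedLengthCapacity hconn hdet hdiv v hα one_pos le_rfl hαlo
        rwa [Real.log_one, mul_zero, sub_zero] at this
  · intro α h1 h2
    obtain ⟨x₀, hx₀, hαm⟩ := exists_mul_meanCost_eq_one hconn hdiv h1 h2
    have hα : 0 < α := pos_of_mul_pos_left (hαm ▸ one_pos) (meanCost_pos hconn hdiv hx₀.1).le
    refine ⟨x₀, hx₀, (mul_deriv_rho_eq_iff hconn hdiv hx₀.1).2 hαm, fun x hx hxe => ?_,
      fun v => ?_⟩
    · have := (mul_deriv_rho_eq_iff hconn hdiv hx.1).1 hxe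
      exact (strictMonoOn_meanCost hconn hdiv).injOn hx.1 hx₀.1
        (mul_left_cancel₀ hα.ne' (this.trans hαm.symm))
    · have hent := meanCost_mul_log_le hconn hdiv hx₀.1
      -- At `α m(x₀) = 1` the exponents of the upper and lower bounds coincide, and nonnegative
      -- entropy again removes the maximum.
      have hexp : α * (Real.log (G.rho x₀) - G.meanCost x₀ * Real.log x₀) =
          -Real.log x₀ + α * Real.log (G.rho x₀) := by
        rw [mul_sub, ← mul_assoc, hαm]
        ring
      have hrw : -Real.logb 2 x₀ + α * Real.logb 2 (G.rho x₀) =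
          (-Real.log x₀ + α * Real.log (G.rho x₀)) / Real.log 2 := by
        rw [Real.logb, Real.logb]
        ring
      have hnn : 0 ≤ (-Real.log x₀ + α * Real.log (G.rho x₀)) / Real.log 2 :=
        div_nonneg (hexp ▸ mul_nonneg hα.le (sub_nonneg.2 hent)) hl2.le
      rw [hrw]
      apply le_antisymm
      · have := fixedLengthCapacity_le hconn hdet hdiv v hα.le hx₀.1 hx₀.2.le
        rwa [max_eq_right hnn] at this
      · rw [← hexp]
        exact le_fixedLengthCapacity hconn hdet hdiv v hα hx₀.1 hx₀.2.le hαm.le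
  · intro v α h
    have h0 := followerCount_eventually_eq_zero hconn hdet hdiv v h
    refine ⟨h0, ?_⟩
    refine Tendsto.limsup_eq (tendsto_const_nhds.congr' ?_)
    filter_upwards [h0] with t ht
    simp [ht]
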